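/- Let $\mu$ be a partition of an integer $w\ge 0$. *Coefficients.* For $n\ge 0$ let $[n]_q=\frac{q^n-q^{-n}}{q-q^{-1}}$. For $h\ge 0$ let $s_\mu[s_h](q^{-1},q)\in\mathbb Z[q,q^{-1}]$ be the plethysm of the Schur polynomials $s_\mu$ and $s_h=s_{(h)}$ in two variables (obtained by substituting the monomials of $s_h(x_0,x_1)$ for the variables of $s_\mu$), evaluated at $x_0=q^{-1}$, $x_1=q$. There are unique integers $a_{\mu[h]}^{[k]}$, $k\ge 1$, almost all zero, with $s_\mu[s_h](q^{-1},q)=\sum_{k\ge 1}a_{\mu[h]}^{[k]}[k]_q$ (the $\mathrm{SL}_2$-plethysm coefficients). Put $$A_\mu(z,q)=\sum_{k\ge 1,\,h\ge 0}a_{\mu[h]}^{[k]}\,q^k z^h .$$ *Quantum Ehrhart series.* For a standard Young tableau $Q$ of shape $\mu$ and $h\ge 0$, let $h\,\mathrm{Ch}(Q)$ be the set of all $v\in[0,h]^w$ such that $Q$ is the recording tableau of the word $v_1v_2\cdots v_w$ under RSK row insertion; for $h\ge 1$ it is the dilate by $h$ of the coarse chamber $\mathrm{Ch}(Q)\subseteq[0,1]^w$.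 With $u=(1,\dots,1)\in\mathbb Z^w$ put $$\mathrm{QEhr}_{\mathrm{Ch}(Q)}(z,q)=\sum_{h\ge 0}\ \Big(\sum_{v} q^{2\langle u,v\rangle}\Big)z^h ,$$ where the inner sum is over all $v\in \big(h\,\mathrm{Ch}(Q)-\tfrac h2u\big)\cap\big(\tfrac h2+\mathbb Z\big)^w$. *Theorem.* The series $\mathrm{QEhr}_{\mathrm{Ch}(Q)}(z,q)$ is the same for all standard Young tableaux $Q$ of shape $\mu$; denote it by $\mathrm{QEhr}_\mu(z,q)$. In the ring $\mathbb Z[q,q^{-1}][[z]]$ one has $$\mathrm{QEhr}_\mu(z,q)=\sum_{h\ge 0}s_\mu[s_h](q^{-1},q)\,z^h\qquad\text{and}\qquad A_\mu(z,q)=\mathsf{PT}^q\big[(q-q^{-1})\,\mathrm{QEhr}_\mu(z,q)\big],$$ where $\mathsf{PT}^q$ is applied to each coefficient of $z^h$ and sends $\sum_{n\in\mathbb Z}c_nq^n$ to $\sum_{n\ge 0}c_nq^n$. -/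

import Mathlib

open scoped LaurentPolynomial
open scoped Pointwise

namespace SL2Plethysm

/-! ### Tableaux, Schur polynomials and plethysm

A partition is a Young diagram `μ`, of size `μ.card`. -/

/-- A standard Young tableau of shape `μ`: a (semistandard) filling in which each of the numbers
`1, …, μ.card` is used exactly once. -/
structure StandardYoungTableau (μ : YoungDiagram) extends SemistandardYoungTableau μ where
  bijOn' : Set.BijOn (fun c : ℕ × ℕ => entry c.1 c.2) μ.cells (Set.Icc 1 μ.card)

/-- `SSYT_N(μ)`: the semistandard tableaux of shape `μ` over the alphabet `{0, …, N - 1}`. -/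
abbrev SSYT (μ : YoungDiagram) (N : ℕ) : Type :=
  {T : SemistandardYoungTableau μ // ∀ c : μ.cells, T c.1.1 c.1.2 < N}

instance (μ : YoungDiagram) (N : ℕ) : Finite (SSYT μ N) := by
  refine Finite.of_injective
    (fun (T : SSYT μ N) (c : μ.cells) => (⟨T.1 c.1.1 c.1.2, T.2 c⟩ : Fin N)) ?_
  intro T T' h
  apply Subtype.ext
  ext i j
  by_cases hc : (i, j) ∈ μ
  · have := congrFun h ⟨(i, j), (YoungDiagram.mem_cells (i, j)).2 hc⟩
    simpa using this
  · rw [T.1.zeros hc, T'.1.zeros hc]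

noncomputable instance (μ : YoungDiagram) (N : ℕ) : Fintype (SSYT μ N) := Fintype.ofFinite _

/-- The monomial `x^{wt(T)}`. -/
noncomputable def weightMonomial {μ : YoungDiagram} {N : ℕ} (T : SSYT μ N) :
    MvPolynomial (Fin N) ℤ :=
  ∏ c : μ.cells, MvPolynomial.X ⟨T.1 c.1.1 c.1.2, T.2 c⟩

/-- The Schur polynomial `s_μ(x_0, …, x_{N-1})`. -/
noncomputable def schurPoly (μ : YoungDiagram) (N : ℕ) : MvPolynomial (Fin N) ℤ :=
  ∑ T : SSYT μ N, weightMonomial T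

/-- The plethysm `s_μ[s_ν](x_0, …, x_{n-1})`: write `s_ν(x_0, …, x_{n-1})` as a sum of monomials
(one for each tableau in `SSYT_n(ν)`) and substitute these monomials for the variables of `s_μ`.
As Schur polynomials are symmetric, the order in which the monomials are listed is irrelevant. -/
noncomputable def plethysm (μ ν : YoungDiagram) (n : ℕ) : MvPolynomial (Fin n) ℤ :=
  MvPolynomial.aeval (fun i => weightMonomial ((Fintype.equivFin (SSYT ν n)).symm i))
    (schurPoly μ (Fintype.card (SSYT ν n)))

/-- The one-row partition `(h)` (the empty partition if `h = 0`). -/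
def oneRow (h : ℕ) : YoungDiagram :=
  YoungDiagram.ofRowLens [h] (List.pairwise_singleton _ h).sortedGE

/-- The Laurent polynomial `s_μ[s_h](q⁻¹, q)`. -/
noncomputable def plethysmSL2 (μ : YoungDiagram) (h : ℕ) : ℤ[T;T⁻¹] :=
  MvPolynomial.aeval ![LaurentPolynomial.T (-1), LaurentPolynomial.T 1] (plethysm μ (oneRow h) 2)

/-! ### `SL₂`-plethysm coefficients -/

/-- The `q`-integer `[n]_q = (q^n - q^{-n}) / (q - q⁻¹)`; see `qInt_spec`. -/
noncomputable def qInt (n : ℕ) : ℤ[T;T⁻¹] :=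
  ∑ i ∈ Finset.range n, LaurentPolynomial.T ((n : ℤ) - 1 - 2 * i)

theorem qInt_spec (n : ℕ) :
    (LaurentPolynomial.T 1 - LaurentPolynomial.T (-1)) * qInt n =
      (LaurentPolynomial.T n - LaurentPolynomial.T (-n) : ℤ[T;T⁻¹]) := by
  have h := Finset.sum_range_sub' (fun i : ℕ => (LaurentPolynomial.T ((n : ℤ) - 2 * i) : ℤ[T;T⁻¹])) n
  have e : (LaurentPolynomial.T (-n : ℤ) : ℤ[T;T⁻¹]) = LaurentPolynomial.T ((n : ℤ) - 2 * n) := by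
    congr 1; ring
  have e0 : (LaurentPolynomial.T (n : ℤ) : ℤ[T;T⁻¹]) =
      LaurentPolynomial.T ((n : ℤ) - 2 * ((0 : ℕ) : ℤ)) := by
    simp
  rw [e, e0, ← h, qInt, Finset.mul_sum]
  refine Finset.sum_congr rfl fun i _ => ?_
  rw [sub_mul, ← LaurentPolynomial.T_add, ← LaurentPolynomial.T_add]
  congr 2
  · ring
  · push_cast
    ring

/-- `f = ∑_{k ≥ 1} a_k [k]_q` with integers `a_k`, almost all zero, and `a_0 = 0`. -/
def IsQIntExpansion (f : ℤ[T;T⁻¹]) (a : ℕ →₀ ℤ) : Prop :=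
  a 0 = 0 ∧ f = a.sum fun k c => LaurentPolynomial.C c * qInt k

/-- The `SL₂`-plethysm coefficients `k ↦ a_{μ[h]}^{[k]}`: the coefficients of the expansion of
`s_μ[s_h](q⁻¹, q)` in `q`-integers. -/
noncomputable def sl2PlethysmCoeff (μ : YoungDiagram) (h : ℕ) : ℕ →₀ ℤ :=
  Classical.epsilon (IsQIntExpansion (plethysmSL2 μ h))

/-- `A_μ(z, q) = ∑_{k ≥ 1, h ≥ 0} a_{μ[h]}^{[k]} q^k z^h`, a power series in `z` over the Laurent
polynomials in `q`. -/
noncomputable def genFun (μ : YoungDiagram) : PowerSeries ℤ[T;T⁻¹] :=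
  PowerSeries.mk fun h => (sl2PlethysmCoeff μ h).sum fun k c =>
    LaurentPolynomial.C c * LaurentPolynomial.T (k : ℤ)

/-! ### The RSK correspondence for words over a linear order -/

section RSK

variable {α : Type*} [LinearOrder α]

/-- Row insertion: `x` replaces the leftmost entry strictly larger than `x`, which is bumped out;
if there is none, `x` is appended at the end of the row. -/
def rowInsert (x : α) : List α → List α × Option α
  | [] => ([x], none)
  | y :: r => if x < y then (x :: r, some y) else (y :: (rowInsert x r).1, (rowInsert x r).2)

/-- Insert `x` in the first row, the bumped entry in the next one, and so on. Returns the new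
tableau (as its list of rows) and the index of the row in which the new cell was created. -/
def tableauInsert : α → List (List α) → List (List α) × ℕ
  | x, [] => ([[x]], 0)
  | x, r :: t =>
    match (rowInsert x r).2 with
    | none => ((rowInsert x r).1 :: t, 0)
    | some y => ((rowInsert x r).1 :: (tableauInsert y t).1, (tableauInsert y t).2 + 1)

/-- Append `k` at the end of row `i`. -/
def appendToRow : ℕ → ℕ → List (List ℕ) → List (List ℕ)
  | _, k, [] => [[k]]
  | 0, k, r :: t => (r ++ [k]) :: t
  | i + 1, k, r :: t => r :: appendToRow i k t

/-- One step of the algorithm: insert the letter `x`, and record the new cell with the label `k`. -/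
def rskStep (s : List (List α) × List (List ℕ)) (x : α) (k : ℕ) :
    List (List α) × List (List ℕ) :=
  ((tableauInsert x s.1).1, appendToRow (tableauInsert x s.1).2 k s.2)

/-- `RSK(v)`: the insertion tableau and the recording tableau (with labels `1, …, w`) of the word
`v_1 v_2 ⋯ v_w`, as lists of rows. -/
def rsk {w : ℕ} (v : Fin w → α) : List (List α) × List (List ℕ) :=
  (List.finRange w).foldl (fun s i => rskStep s (v i) (i + 1)) ([], [])

/-- The recording tableau `RSK(v)_2` as a function of row and column, zero outside its shape. -/
def recordingTableau {w : ℕ} (v : Fin w → α) (i j : ℕ) : ℕ :=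
  ((rsk v).2.getD i []).getD j 0

end RSK

/-! ### Coarse chambers and the quantum Ehrhart series -/

/-- The `h`-th dilate of the coarse chamber of `Q`: the points of the dilated cube `h[0,1]^w` whose
recording tableau is `Q`. For `h ≥ 1` it is the image of the coarse chamber under scaling by `h`,
see `dilatedCoarseChamber_eq_smul`. -/
def dilatedCoarseChamber {μ : YoungDiagram} (Q : StandardYoungTableau μ) (h : ℕ) :
    Set (Fin μ.card → ℝ) :=
  {v | (∀ i, 0 ≤ v i ∧ v i ≤ h) ∧ recordingTableau v = Q.entry}

/-- The coarse chamber of `Q`: the points of the unit cube whose recording tableau is `Q`. -/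
def coarseChamber {μ : YoungDiagram} (Q : StandardYoungTableau μ) : Set (Fin μ.card → ℝ) :=
  {v | (∀ i, 0 ≤ v i ∧ v i ≤ 1) ∧ recordingTableau v = Q.entry}

section Scaling

variable {α β : Type*} [LinearOrder α] [LinearOrder β] {f : α → β}

theorem rowInsert_map (hf : StrictMono f) (x : α) (r : List α) :
    rowInsert (f x) (r.map f) = ((rowInsert x r).1.map f, (rowInsert x r).2.map f) := by
  induction r with
  | nil => simp [rowInsert]
  | cons y r ih =>
    simp only [List.map_cons, rowInsert, hf.lt_iff_lt, ih]
    split_ifs <;> simp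

theorem tableauInsert_map (hf : StrictMono f) (x : α) (t : List (List α)) :
    tableauInsert (f x) (t.map (List.map f)) =
      ((tableauInsert x t).1.map (List.map f), (tableauInsert x t).2) := by
  induction t generalizing x with
  | nil => simp [tableauInsert]
  | cons r t ih =>
    simp only [List.map_cons, tableauInsert, rowInsert_map hf]
    cases (rowInsert x r).2 <;> simp [ih]

theorem recordingTableau_comp (hf : StrictMono f) {w : ℕ} (v : Fin w → α) :
    recordingTableau (fun i => f (v i)) = recordingTableau v := by
  have key : ∀ (l : List (Fin w)) (s : List (List α) × List (List ℕ)),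
      l.foldl (fun s i => rskStep s (f (v i)) (i + 1)) (s.1.map (List.map f), s.2) =
        ((l.foldl (fun s i => rskStep s (v i) (i + 1)) s).1.map (List.map f),
          (l.foldl (fun s i => rskStep s (v i) (i + 1)) s).2) := by
    intro l
    induction l with
    | nil => intro s; rfl
    | cons i l ih =>
      intro s
      simp only [List.foldl_cons]
      rw [← ih]
      simp [rskStep, tableauInsert_map hf]
  have h := key (List.finRange w) ([], [])
  funext i j
  simp only [recordingTableau, rsk]
  simp only [List.map_nil] at h
  rw [h]

end Scaling

theorem dilatedCoarseChamber_eq_smul {μ : YoungDiagram} (Q : StandardYoungTableau μ) {h : ℕ}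
    (hh : 1 ≤ h) : dilatedCoarseChamber Q h = (h : ℝ) • coarseChamber Q := by
  have hpos : (0 : ℝ) < h := by exact_mod_cast hh
  ext v
  rw [Set.mem_smul_set_iff_inv_smul_mem₀ hpos.ne']
  have hf : StrictMono fun x : ℝ => (h : ℝ)⁻¹ * x := fun a b hab =>
    mul_lt_mul_of_pos_left hab (inv_pos.2 hpos)
  have hr : recordingTableau ((h : ℝ)⁻¹ • v) = recordingTableau v := recordingTableau_comp hf v
  simp only [dilatedCoarseChamber, coarseChamber, Set.mem_ofPred_eq, hr, Pi.smul_apply, smul_eq_mul]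
  refine and_congr_left fun _ => forall_congr' fun i => and_congr ?_ ?_
  · exact (mul_nonneg_iff_of_pos_left (inv_pos.2 hpos)).symm
  · rw [inv_mul_le_iff₀ hpos, mul_one]

/-- The lattice `L_h = (h/2 + ℤ)^w`. -/
def shiftedLattice (w h : ℕ) : Set (Fin w → ℝ) :=
  {v | ∀ i, ∃ n : ℤ, v i = (h : ℝ) / 2 + n}

/-- The quantum Ehrhart polynomial `∑ q^{2⟨u, v⟩}`, the sum over the points `v ∈ L_h` of
`h(P - u/2) = hP - (h/2)u`, where `u = (1, …, 1)`, of a bounded set `P` whose `h`-th dilate `hP` is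
given. The exponent `2⟨u, v⟩` is an integer for `v ∈ L_h`, so the floor only changes its type. -/
noncomputable def quantumEhrhartPoly {w : ℕ} (hP : Set (Fin w → ℝ)) (h : ℕ) : ℤ[T;T⁻¹] :=
  ∑ᶠ v ∈ ((fun x : Fin w → ℝ => fun i => x i - (h : ℝ) / 2) '' hP) ∩ shiftedLattice w h,
    LaurentPolynomial.T ⌊2 * ∑ i, v i⌋

/-- The quantum Ehrhart series of a half-open polytope with the dilates `P 0, P 1, P 2, …`. -/
noncomputable def quantumEhrhartSeries {w : ℕ} (P : ℕ → Set (Fin w → ℝ)) :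
    PowerSeries ℤ[T;T⁻¹] :=
  PowerSeries.mk fun h => quantumEhrhartPoly (P h) h

theorem sum_rowLen_le_card (μ : YoungDiagram) (n : ℕ) :
    ∑ i ∈ Finset.range n, μ.rowLen i ≤ μ.card := by
  have hd : ((Finset.range n : Finset ℕ) : Set ℕ).PairwiseDisjoint μ.row := by
    intro a _ b _ hab
    refine Finset.disjoint_left.2 fun c hc hc' => hab ?_
    rw [← (YoungDiagram.mem_row_iff.1 hc).2, (YoungDiagram.mem_row_iff.1 hc').2]
  simp only [YoungDiagram.rowLen_eq_card]
  rw [← Finset.card_biUnion hd]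
  refine Finset.card_le_card fun c hc => ?_
  obtain ⟨i, _, hi⟩ := Finset.mem_biUnion.1 hc
  exact (YoungDiagram.mem_cells c).2 (YoungDiagram.mem_row_iff.1 hi).1

/-- The entries of the tableau whose rows are filled one after the other. -/
def rowFilling (μ : YoungDiagram) (i j : ℕ) : ℕ :=
  if (i, j) ∈ μ then ∑ k ∈ Finset.range i, μ.rowLen k + (j + 1) else 0

theorem rowFilling_lt (μ : YoungDiagram) {i i' j j' : ℕ} (hi : i < i') (hc : (i, j) ∈ μ)
    (hc' : (i', j') ∈ μ) : rowFilling μ i j < rowFilling μ i' j' := by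
  have h1 := YoungDiagram.mem_iff_lt_rowLen.1 hc
  have h2 : ∑ k ∈ Finset.range (i + 1), μ.rowLen k ≤ ∑ k ∈ Finset.range i', μ.rowLen k :=
    Finset.sum_le_sum_of_subset (Finset.range_subset_range.2 hi)
  rw [Finset.sum_range_succ] at h2
  simp only [rowFilling, hc, hc', if_true]
  omega

/-- Every shape has a standard Young tableau. -/
instance (μ : YoungDiagram) : Nonempty (StandardYoungTableau μ) := by
  have hmaps : Set.MapsTo (fun c : ℕ × ℕ => rowFilling μ c.1 c.2) (μ.cells : Set (ℕ × ℕ))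
      (Finset.Icc 1 μ.card : Finset ℕ) := by
    rintro ⟨i, j⟩ hc
    have hc : (i, j) ∈ μ := (YoungDiagram.mem_cells _).1 hc
    have h1 := YoungDiagram.mem_iff_lt_rowLen.1 hc
    have h2 := sum_rowLen_le_card μ (i + 1)
    rw [Finset.sum_range_succ] at h2
    simp only [rowFilling, hc, if_true, Finset.coe_Icc, Set.mem_Icc]
    omega
  have hinj : Set.InjOn (fun c : ℕ × ℕ => rowFilling μ c.1 c.2) (μ.cells : Set (ℕ × ℕ)) := by
    rintro ⟨i, j⟩ hc ⟨i', j'⟩ hc' h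
    have hc : (i, j) ∈ μ := (YoungDiagram.mem_cells _).1 hc
    have hc' : (i', j') ∈ μ := (YoungDiagram.mem_cells _).1 hc'
    rcases lt_trichotomy i i' with hi | rfl | hi
    · exact absurd h (rowFilling_lt μ hi hc hc').ne
    · simp only [rowFilling, hc, hc', if_true] at h
      ext <;> simp
      omega
    · exact absurd h (rowFilling_lt μ hi hc' hc).ne'
  refine ⟨⟨⟨rowFilling μ, ?_, ?_, fun hc => if_neg hc⟩, ?_⟩⟩
  · intro i j j' hj hc
    have hc' : (i, j) ∈ μ := μ.up_left_mem le_rfl hj.le hc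
    simp only [rowFilling, hc, hc', if_true]
    omega
  · intro i i' j hi hc
    exact rowFilling_lt μ hi (μ.up_left_mem hi.le le_rfl hc) hc
  · have hs := Finset.surjOn_of_injOn_of_card_le _ hmaps hinj (by simp)
    rw [Finset.coe_Icc] at hmaps hs
    exact ⟨hmaps, hinj, hs⟩

/-- `QEhr_μ(z, q)`: the quantum Ehrhart series of the coarse chamber of a standard Young tableau of
shape `μ`. -/
noncomputable def QEhr (μ : YoungDiagram) : PowerSeries ℤ[T;T⁻¹] :=
  quantumEhrhartSeries (dilatedCoarseChamber (Classical.arbitrary (StandardYoungTableau μ)))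

/-! ### The positive term operator -/

/-- `∑ a_n q^n ↦ ∑_{n ≥ 0} a_n q^n` on Laurent polynomials. -/
noncomputable def positivePart (f : ℤ[T;T⁻¹]) : ℤ[T;T⁻¹] :=
  AddMonoidAlgebra.ofCoeff (f.coeff.filter fun n => 0 ≤ n)

/-- The positive term operator `PT^q` on power series in `z` over the Laurent polynomials in `q`. -/
noncomputable def PT (F : PowerSeries ℤ[T;T⁻¹]) : PowerSeries ℤ[T;T⁻¹] :=
  PowerSeries.mk fun h => positivePart (PowerSeries.coeff h F)

end SL2Plethysm

/-!
The lattice points of the `h`-th dilate of the coarse chamber of `Q`, shifted by `h / 2`, are the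
words `v` of length `w` in the letters `0, …, h` whose recording tableau is `Q`, and such a point
contributes `∏ q^{2 v_i - h}`. By the Robinson–Schensted–Knuth correspondence, `v` is determined by
its insertion tableau, which runs through all semistandard tableaux of shape `μ` with entries in
`{0, …, h}` and has the letters of `v` as its entries. Hence, for every `Q`, the sum over these
words is the Schur polynomial `s_μ` evaluated at `q^{-h}, q^{2-h}, …, q^h`
(`sum_words_eq_sum_tableaux`). These arguments are the values of the monomials of `s_h(x_0, x_1)` at
`(q⁻¹, q)`, so the sum is `s_μ[s_h](q⁻¹, q)`.

The correspondence is proved by reversing a single insertion (`tableauInsert_injective`,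
`exists_tableauInsert_eq`): since an insertion ends in a new corner of the shape, and this corner
can be read off from the recording tableau, the last letter and the previous insertion tableau can be
recovered. The recording tableau is encoded by its row word, the list of the rows in which
the labels `1, 2, …` are placed.

Symmetry of the Schur polynomials, proved by Bender–Knuth involutions (`aeval_comp_schurPoly`), is
needed twice. It makes the plethysm independent of the order in which the monomials of `s_h` are
listed, and it shows that `s_μ[s_h](q⁻¹, q)` is invariant under `q ↦ q⁻¹`. For an invariant Laurent
polynomial `f`, the product `(q - q⁻¹) f` is antisymmetric, hence a unique combination
`∑_{k ≥ 1} a_k (q^k - q^{-k})`; this gives `f = ∑ a_k [k]_q`, and the terms with nonnegative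
exponent are `∑ a_k q^k` (`exists_isQIntExpansion`, `IsQIntExpansion.positivePart_mul`).
-/

namespace SL2Plethysm

/-! ### Row insertion and its inverse -/

section Insertion

variable {α : Type*} [LinearOrder α]

/-- The row `r` may stand directly above the row `s` in a tableau: every entry of `s` has a strictly
smaller entry of `r` above it. -/
def Over (r s : List α) : Prop :=
  ∀ (j : ℕ) (b : α), s[j]? = some b → ∃ a, r[j]? = some a ∧ a < b

/-- Row insertion changes exactly one position `p`, and the entry bumped out is the old content of
`p`; it is `none` when `p` is the end of the row. -/
theorem exists_rowInsert_position (x : α) (r : List α) :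
    ∃ p ≤ r.length, (∀ j, (rowInsert x r).1[j]? = if j = p then some x else r[j]?) ∧
      (rowInsert x r).2 = r[p]? ∧ (∀ j < p, ∀ z, r[j]? = some z → z ≤ x) ∧
      ∀ z, r[p]? = some z → x < z := by
  induction r with
  | nil => exact ⟨0, by simp, by simp [rowInsert, List.getElem?_cons], by simp [rowInsert]⟩
  | cons y r ih =>
    by_cases hxy : x < y
    · refine ⟨0, by simp, fun j => ?_, by simp [rowInsert, hxy], by simp, by simpa using hxy⟩
      cases j <;> simp [rowInsert, hxy]
    · obtain ⟨p, hp, h1, h2, h3, h4⟩ := ih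
      refine ⟨p + 1, by simpa using hp, fun j => ?_, by simpa [rowInsert, hxy] using h2, ?_,
        by simpa using h4⟩
      · cases j <;> simp [rowInsert, hxy, h1]
      · rintro (_ | j) hj z hz
        · simp only [List.getElem?_cons_zero, Option.some.injEq] at hz
          exact hz ▸ not_lt.1 hxy
        · exact h3 j (by omega) z (by simpa using hz)

theorem rowInsert_of_forall_le {x : α} {r : List α} (h : ∀ z ∈ r, z ≤ x) :
    rowInsert x r = (r ++ [x], none) := by
  induction r with
  | nil => rfl
  | cons y r ih =>
    simp only [List.forall_mem_cons] at h
    simp [rowInsert, not_lt.2 h.1, ih h.2]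

theorem rowInsert_append_cons {x y : α} {a : List α} (b : List α) (h : ∀ z ∈ a, z ≤ x)
    (hxy : x < y) : rowInsert x (a ++ y :: b) = (a ++ x :: b, some y) := by
  induction a with
  | nil => simp [rowInsert, hxy]
  | cons z a ih =>
    simp only [List.forall_mem_cons] at h
    simp [rowInsert, not_lt.2 h.1, ih h.2]

theorem rowInsert_of_eq_none {x : α} {r : List α} (h : (rowInsert x r).2 = none) :
    (rowInsert x r).1 = r ++ [x] ∧ ∀ z ∈ r, z ≤ x := by
  induction r with
  | nil => simp [rowInsert]
  | cons y r ih =>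
    by_cases hxy : x < y
    · simp [rowInsert, hxy] at h
    · simp only [rowInsert, hxy, if_false] at h ⊢
      simp [ih h, not_lt.1 hxy]
      exact (ih h).2

theorem rowInsert_of_eq_some {x y : α} {r : List α} (h : (rowInsert x r).2 = some y) :
    ∃ a b, r = a ++ y :: b ∧ (rowInsert x r).1 = a ++ x :: b ∧ (∀ z ∈ a, z ≤ x) ∧ x < y := by
  induction r with
  | nil => simp [rowInsert] at h
  | cons z r ih =>
    by_cases hxz : x < z
    · simp only [rowInsert, hxz, if_true, Option.some.injEq] at h ⊢
      subst h
      exact ⟨[], r, rfl, rfl, by simp, hxz⟩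
    · simp only [rowInsert, hxz, if_false] at h ⊢
      obtain ⟨a, b, rfl, h2, h3, h4⟩ := ih h
      exact ⟨z :: a, b, rfl, by simp [h2], by simpa using ⟨not_lt.1 hxz, h3⟩, h4⟩

theorem pairwise_rowInsert {x : α} {r : List α} (hr : r.Pairwise (· ≤ ·)) :
    (rowInsert x r).1.Pairwise (· ≤ ·) := by
  rcases h : (rowInsert x r).2 with _ | y
  · obtain ⟨h1, h2⟩ := rowInsert_of_eq_none h
    rw [h1, List.pairwise_append]
    exact ⟨hr, by simp, by simpa using h2⟩
  · obtain ⟨a, b, rfl, h2, h3, h4⟩ := rowInsert_of_eq_some h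
    rw [h2]
    simp only [List.pairwise_append, List.pairwise_cons, List.forall_mem_cons] at hr ⊢
    exact ⟨hr.1, ⟨fun z hz => h4.le.trans (hr.2.1.1 z hz), hr.2.1.2⟩,
      fun z hz => ⟨h3 z hz, (hr.2.2 z hz).2⟩⟩

theorem getElem?_mono {r : List α} (hr : r.Pairwise (· ≤ ·)) {i j : ℕ} {a b : α} (hij : i ≤ j)
    (ha : r[i]? = some a) (hb : r[j]? = some b) : a ≤ b := by
  obtain ⟨hi, rfl⟩ := List.getElem?_eq_some_iff.1 ha
  obtain ⟨hj, rfl⟩ := List.getElem?_eq_some_iff.1 hb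
  rcases hij.eq_or_lt with rfl | h
  · exact le_rfl
  · exact List.pairwise_iff_getElem.1 hr i j hi hj h

/-- A sorted row and a letter are determined by the outcome of a bumping insertion. -/
theorem rowInsert_injective_of_some {x x' y : α} {r r' : List α} (hr : r.Pairwise (· ≤ ·))
    (hr' : r'.Pairwise (· ≤ ·)) (h1 : (rowInsert x r).1 = (rowInsert x' r').1)
    (h2 : (rowInsert x r).2 = some y) (h3 : (rowInsert x' r').2 = some y) : x = x' ∧ r = r' := by
  obtain ⟨p, hp, a1, a2, a3, a4⟩ := exists_rowInsert_position x r
  obtain ⟨p', hp', b1, b2, b3, b4⟩ := exists_rowInsert_position x' r'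
  rw [h2] at a2
  rw [h3] at b2
  have e : ∀ j, (if j = p then some x else r[j]?) = if j = p' then some x' else r'[j]? := by
    intro j; rw [← a1, ← b1, h1]
  have hxy := a4 y a2.symm
  have hxy' := b4 y b2.symm
  -- The position of the new letter is the last one whose entry is smaller than `y`.
  have hpp : p = p' := by
    rcases lt_trichotomy p p' with h | h | h
    · have := e p'
      simp only [h.ne', if_false, if_true] at this
      exact absurd (getElem?_mono hr h.le a2.symm this) (not_le.2 hxy')
    · exact h
    · have := e p
      simp only [h.ne', if_false, if_true] at this
      exact absurd (getElem?_mono hr' h.le b2.symm this.symm) (not_le.2 hxy)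
  subst hpp
  refine ⟨by simpa using e p, List.ext_getElem? fun j => ?_⟩
  by_cases hj : j = p
  · rw [hj, ← a2, ← b2]
  · simpa [hj] using e j

theorem over_rowInsert_of_none {x : α} {r s : List α} (h : Over r s)
    (hx : (rowInsert x r).2 = none) : Over (rowInsert x r).1 s := by
  rw [(rowInsert_of_eq_none hx).1]
  intro j b hb
  obtain ⟨a, ha, hab⟩ := h j b hb
  exact ⟨a, by rw [List.getElem?_append_left (List.getElem?_eq_some_iff.1 ha).1, ha], hab⟩

/-- Inserting into a row and then the bumped letter into the row below keeps columns strict. -/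
theorem over_rowInsert_of_some {x y : α} {r s : List α} (h : Over r s)
    (hx : (rowInsert x r).2 = some y) : Over (rowInsert x r).1 (rowInsert y s).1 := by
  obtain ⟨p, hp, a1, a2, a3, a4⟩ := exists_rowInsert_position x r
  obtain ⟨p', hp', b1, -, b3, b4⟩ := exists_rowInsert_position y s
  rw [hx] at a2
  have hxy := a4 y a2.symm
  -- The new cell in the lower row lies weakly to the left of the one in the upper row.
  have hpp : p' ≤ p := by
    by_contra! hlt
    obtain ⟨b, hb⟩ : ∃ b, s[p]? = some b := ⟨s[p], List.getElem?_eq_getElem (by omega)⟩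
    obtain ⟨a, ha, hab⟩ := h p b hb
    have := b3 p hlt b hb
    rw [← a2] at ha
    cases ha
    exact absurd hab (not_lt.2 this)
  have hplen : p < r.length := (List.getElem?_eq_some_iff.1 a2.symm).1
  intro j b hb
  rw [b1] at hb
  rw [a1]
  split_ifs at hb ⊢ with h1 h2 h2
  · cases hb; exact ⟨x, rfl, hxy⟩
  · obtain ⟨a, ha, hab⟩ := h j b hb
    subst h1
    rw [← a2] at ha
    cases ha
    exact ⟨x, rfl, hxy.trans hab⟩
  · cases hb
    obtain ⟨z, hz⟩ : ∃ z, r[j]? = some z := ⟨r[j], List.getElem?_eq_getElem (by omega)⟩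
    exact ⟨z, hz, (a3 j (by omega) z hz).trans_lt hxy⟩
  · exact h j b hb

/-- Reverse row insertion: if the lower row `s'` has just received the letter `y`, then `y` was
bumped out of the upper row. -/
theorem exists_rowInsert_eq_of_over {y : α} {r' s : List α} (hr' : r'.Pairwise (· ≤ ·))
    (hs : s.Pairwise (· ≤ ·)) (h : Over r' (rowInsert y s).1) :
    ∃ x r, rowInsert x r = (r', some y) ∧ r.Pairwise (· ≤ ·) ∧ Over r s := by
  obtain ⟨p, hp, b1, -, b3, b4⟩ := exists_rowInsert_position y s
  obtain ⟨w, hw, hwy⟩ := h p y (by simp [b1])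
  -- Split `r'` behind its last entry smaller than `y`.
  obtain ⟨a, x, b, rfl, hxy, hby⟩ : ∃ a x b, r' = a ++ x :: b ∧ x < y ∧ ∀ z ∈ b, y ≤ z := by
    have : ∃ z ∈ r', z < y := ⟨w, List.mem_of_getElem? hw, hwy⟩
    clear h hw hr'
    induction r' with
    | nil => simp at this
    | cons z r ih =>
      by_cases hr : ∃ z ∈ r, z < y
      · obtain ⟨a, x, b, rfl, h1, h2⟩ := ih hr
        exact ⟨z :: a, x, b, rfl, h1, h2⟩
      · push Not at hr
        refine ⟨[], z, r, rfl, ?_, hr⟩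
        obtain ⟨z', hz', hlt⟩ := this
        rcases List.mem_cons.1 hz' with rfl | h
        · exact hlt
        · exact absurd hlt (not_lt.2 (hr _ h))
  simp only [List.pairwise_append, List.pairwise_cons, List.forall_mem_cons] at hr'
  obtain ⟨s1, ⟨s2, s3⟩, s4⟩ := hr'
  have hsorted : (a ++ y :: b).Pairwise (· ≤ ·) := by
    simp only [List.pairwise_append, List.pairwise_cons, List.forall_mem_cons]
    exact ⟨s1, ⟨hby, s3⟩, fun z hz => ⟨(s4 z hz).1.trans hxy.le, (s4 z hz).2⟩⟩
  refine ⟨x, a ++ y :: b, rowInsert_append_cons b (fun z hz => (s4 z hz).1) hxy, hsorted, ?_⟩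
  have hpa : p ≤ a.length := by
    by_contra! hlt
    obtain ⟨c, hc⟩ : ∃ c, p = a.length + (c + 1) := ⟨p - a.length - 1, by omega⟩
    rw [hc, List.getElem?_append_right (by omega)] at hw
    simp only [Nat.add_sub_cancel_left, List.getElem?_cons_succ] at hw
    exact absurd hwy (not_lt.2 (hby w (List.mem_of_getElem? hw)))
  intro j c hc
  by_cases hj : j = a.length
  · subst hj
    refine ⟨y, by simp, ?_⟩
    obtain ⟨z, hz⟩ : ∃ z, s[p]? = some z :=
      ⟨s[p]'(by have := (List.getElem?_eq_some_iff.1 hc).1; omega), List.getElem?_eq_getElem _⟩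
    exact (b4 z hz).trans_le (getElem?_mono hs hpa hz hc)
  · have hrj : (a ++ y :: b)[j]? = (a ++ x :: b)[j]? := by
      rcases Nat.lt_or_gt_of_ne hj with hlt | hgt
      · rw [List.getElem?_append_left hlt, List.getElem?_append_left hlt]
      · obtain ⟨k, rfl⟩ : ∃ k, j = a.length + (k + 1) := ⟨j - a.length - 1, by omega⟩
        rw [List.getElem?_append_right (by omega), List.getElem?_append_right (by omega)]
        simp
    rw [hrj]
    by_cases hjp : j = p
    · subst hjp
      exact ⟨w, hw, hwy.trans (b4 c hc)⟩
    · exact h j c (by simp [b1, hjp, hc])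

/-! ### Tableau insertion -/

/-- A list of rows is a semistandard tableau: the rows are nonempty and weakly increasing, and
columns are strictly increasing. -/
def IsTableau : List (List α) → Prop
  | [] => True
  | r :: t => r ≠ [] ∧ r.Pairwise (· ≤ ·) ∧ Over r (t.headD []) ∧ IsTableau t

theorem over_nil (r : List α) : Over r [] := by intro j b h; simp at h

theorem rowInsert_ne_nil (x : α) (r : List α) : (rowInsert x r).1 ≠ [] := by
  cases r with
  | nil => simp [rowInsert]
  | cons y r => by_cases h : x < y <;> simp [rowInsert, h]

theorem tableauInsert_cons_of_none {x : α} {r : List α} (t : List (List α))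
    (h : (rowInsert x r).2 = none) : tableauInsert x (r :: t) = ((rowInsert x r).1 :: t, 0) := by
  simp [tableauInsert, h]

theorem tableauInsert_cons_of_some {x y : α} {r : List α} (t : List (List α))
    (h : (rowInsert x r).2 = some y) : tableauInsert x (r :: t) =
      ((rowInsert x r).1 :: (tableauInsert y t).1, (tableauInsert y t).2 + 1) := by
  simp [tableauInsert, h]

theorem headD_tableauInsert (x : α) (t : List (List α)) :
    (tableauInsert x t).1.headD [] = (rowInsert x (t.headD [])).1 := by
  cases t with
  | nil => rfl
  | cons r t =>
    rcases h : (rowInsert x r).2 with _ | y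
    · simp [tableauInsert_cons_of_none t h]
    · simp [tableauInsert_cons_of_some t h]

theorem IsTableau.pairwise_headD {t : List (List α)} (h : IsTableau t) :
    (t.headD []).Pairwise (· ≤ ·) := by
  cases t with
  | nil => simp
  | cons r t => exact h.2.1

theorem IsTableau.tableauInsert {t : List (List α)} (ht : IsTableau t) (x : α) :
    IsTableau (tableauInsert x t).1 := by
  induction t generalizing x with
  | nil => exact ⟨by simp, by simp, over_nil _, trivial⟩
  | cons r t ih =>
    obtain ⟨h1, h2, h3, h4⟩ := ht
    rcases h : (rowInsert x r).2 with _ | y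
    · rw [tableauInsert_cons_of_none t h]
      exact ⟨rowInsert_ne_nil x r, pairwise_rowInsert h2, over_rowInsert_of_none h3 h, h4⟩
    · rw [tableauInsert_cons_of_some t h]
      refine ⟨rowInsert_ne_nil x r, pairwise_rowInsert h2, ?_, ih h4 y⟩
      rw [headD_tableauInsert]
      exact over_rowInsert_of_some h3 h

theorem tableauInsert_injective {t t' : List (List α)} (ht : IsTableau t) (ht' : IsTableau t')
    {x x' : α} (h : tableauInsert x t = tableauInsert x' t') : x = x' ∧ t = t' := by
  induction t generalizing x x' t' with
  | nil =>
    cases t' with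
    | nil => simpa [SL2Plethysm.tableauInsert] using h
    | cons r' t' =>
      rcases e' : (rowInsert x' r').2 with _ | y'
      · rw [tableauInsert_cons_of_none t' e', (rowInsert_of_eq_none e').1] at h
        have := ht'.1
        simp [SL2Plethysm.tableauInsert] at h
        have hlen := congrArg List.length h.1
        simp at hlen
        exact absurd hlen this
      · simp [SL2Plethysm.tableauInsert, e'] at h
  | cons r t ih =>
    cases t' with
    | nil =>
      rcases e : (rowInsert x r).2 with _ | y
      · rw [tableauInsert_cons_of_none t e, (rowInsert_of_eq_none e).1] at h
        have := ht.1
        simp [SL2Plethysm.tableauInsert] at h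
        have hlen := congrArg List.length h.1
        simp at hlen
        exact absurd hlen this
      · simp [SL2Plethysm.tableauInsert, e] at h
    | cons r' t' =>
      rcases e : (rowInsert x r).2 with _ | y <;> rcases e' : (rowInsert x' r').2 with _ | y'
      · rw [tableauInsert_cons_of_none t e, tableauInsert_cons_of_none t' e',
          (rowInsert_of_eq_none e).1, (rowInsert_of_eq_none e').1] at h
        simp only [Prod.mk.injEq, List.cons.injEq, and_true] at h
        obtain ⟨h1, h2⟩ := List.append_inj' h.1 rfl
        exact ⟨by simpa using h2, by rw [h1, h.2]⟩
      · simp [SL2Plethysm.tableauInsert, e, e'] at h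
      · simp [SL2Plethysm.tableauInsert, e, e'] at h
      · rw [tableauInsert_cons_of_some t e, tableauInsert_cons_of_some t' e'] at h
        simp only [Prod.mk.injEq, List.cons.injEq, add_left_inj] at h
        obtain ⟨rfl, rfl⟩ := ih ht.2.2.2 ht'.2.2.2 (Prod.ext h.1.2 h.2)
        obtain ⟨rfl, rfl⟩ := rowInsert_injective_of_some ht.2.1 ht'.2.1 h.1.1 e e'
        exact ⟨rfl, rfl⟩

/-- Reverse insertion: a tableau arises by an insertion that ends in row `i` whenever the last cell
of this row is a corner. -/
theorem exists_tableauInsert_eq {t' : List (List α)} (ht' : IsTableau t') {i : ℕ}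
    (hi : (t'.getD (i + 1) []).length < (t'.getD i []).length) :
    ∃ x t, IsTableau t ∧ tableauInsert x t = (t', i) := by
  induction t' generalizing i with
  | nil => simp at hi
  | cons r' t' ih =>
    obtain ⟨h1, h2, h3, h4⟩ := ht'
    cases i with
    | zero =>
      obtain ⟨r, x, rfl⟩ := (List.eq_nil_or_concat' r').resolve_left h1
      simp only [List.pairwise_append, List.mem_singleton, forall_eq] at h2
      rcases eq_or_ne r [] with rfl | hr
      · refine ⟨x, [], trivial, ?_⟩
        cases t' with
        | nil => rfl
        | cons s t' =>
          have : s ≠ [] := h4.1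
          simp [this] at hi
      · refine ⟨x, r :: t', ⟨hr, h2.1, ?_, h4⟩, ?_⟩
        · have hlen : (t'.headD []).length ≤ r.length := by
            cases t' <;> simp at hi ⊢
            omega
          intro j b hb
          obtain ⟨a, ha, hab⟩ := h3 j b hb
          rw [List.getElem?_append_left
            ((List.getElem?_eq_some_iff.1 hb).1.trans_le hlen)] at ha
          exact ⟨a, ha, hab⟩
        · simp [tableauInsert, rowInsert_of_forall_le h2.2.2]
    | succ i =>
      simp only [List.getD_cons_succ] at hi
      obtain ⟨y, t, ht, e⟩ := ih h4 hi
      have e1 : (tableauInsert y t).1 = t' := by rw [e]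
      rw [← e1, headD_tableauInsert] at h3
      obtain ⟨x, r, hx, hr, hrt⟩ := exists_rowInsert_eq_of_over h2 ht.pairwise_headD h3
      refine ⟨x, r :: t, ⟨?_, hr, hrt, ht⟩, ?_⟩
      · rintro rfl
        simp [rowInsert] at hx
      · simp [tableauInsert, hx, e]

theorem length_rowInsert (x : α) (r : List α) :
    (rowInsert x r).1.length = r.length + if (rowInsert x r).2 = none then 1 else 0 := by
  rcases h : (rowInsert x r).2 with _ | y
  · simp [(rowInsert_of_eq_none h).1]
  · obtain ⟨a, b, e, h2, -⟩ := rowInsert_of_eq_some h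
    rw [h2, e]
    simp

theorem length_getD_tableauInsert (x : α) (t : List (List α)) (k : ℕ) :
    ((tableauInsert x t).1.getD k []).length =
      (t.getD k []).length + if k = (tableauInsert x t).2 then 1 else 0 := by
  induction t generalizing x k with
  | nil => cases k <;> simp [tableauInsert]
  | cons r t ih =>
    rcases h : (rowInsert x r).2 with _ | y
    · rw [tableauInsert_cons_of_none t h]
      cases k <;> simp [length_rowInsert, h]
    · rw [tableauInsert_cons_of_some t h]
      cases k with
      | zero => simp [length_rowInsert, h]
      | succ k => simpa using ih y k

theorem tableauInsert_snd_le (x : α) (t : List (List α)) : (tableauInsert x t).2 ≤ t.length := by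
  induction t generalizing x with
  | nil => simp [tableauInsert]
  | cons r t ih =>
    rcases h : (rowInsert x r).2 with _ | y
    · simp [tableauInsert_cons_of_none t h]
    · simp [tableauInsert_cons_of_some t h, ih y]

theorem length_tableauInsert (x : α) (t : List (List α)) :
    (tableauInsert x t).1.length = max t.length ((tableauInsert x t).2 + 1) := by
  induction t generalizing x with
  | nil => simp [tableauInsert]
  | cons r t ih =>
    rcases h : (rowInsert x r).2 with _ | y
    · simp [tableauInsert_cons_of_none t h]
    · simp [tableauInsert_cons_of_some t h, ih y]

/-- Insertion preserves the content. -/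
theorem flatten_tableauInsert_perm (x : α) (t : List (List α)) :
    (tableauInsert x t).1.flatten.Perm (x :: t.flatten) := by
  induction t generalizing x with
  | nil => simp [tableauInsert]
  | cons r t ih =>
    rcases h : (rowInsert x r).2 with _ | y
    · rw [tableauInsert_cons_of_none t h, (rowInsert_of_eq_none h).1]
      simp
    · rw [tableauInsert_cons_of_some t h]
      obtain ⟨a, b, rfl, h2, -⟩ := rowInsert_of_eq_some h
      rw [h2]
      simp only [List.flatten_cons, List.append_assoc, List.cons_append]
      refine List.perm_middle.trans (List.Perm.cons _ (List.Perm.append_left _ ?_))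
      exact ((ih y).append_left b).trans List.perm_middle

end Insertion

/-! ### Words, row words and recording tableaux -/

section Words

variable {α : Type*} [LinearOrder α]

/-- The insertion tableau of a word, together with its row word: the list of the rows in which the
successive insertions end. The row word encodes the recording tableau. -/
def insertWord (l : List α) : List (List α) × List ℕ :=
  l.foldl (fun s x => ((tableauInsert x s.1).1, s.2 ++ [(tableauInsert x s.1).2])) ([], [])

theorem insertWord_concat (l : List α) (x : α) :
    insertWord (l ++ [x]) = ((tableauInsert x (insertWord l).1).1,
      (insertWord l).2 ++ [(tableauInsert x (insertWord l).1).2]) := by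
  simp [insertWord]

theorem isTableau_insertWord (l : List α) : IsTableau (insertWord l).1 := by
  induction l using List.reverseRecOn with
  | nil => trivial
  | append_singleton l x ih => rw [insertWord_concat]; exact ih.tableauInsert x

theorem length_insertWord_snd (l : List α) : (insertWord l).2.length = l.length := by
  induction l using List.reverseRecOn with
  | nil => rfl
  | append_singleton l x ih => simp [insertWord_concat, ih]

theorem length_getD_insertWord (l : List α) (k : ℕ) :
    ((insertWord l).1.getD k []).length = (insertWord l).2.count k := by
  induction l using List.reverseRecOn with
  | nil => simp [insertWord]
  | append_singleton l x ih =>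
    simp only [insertWord_concat, length_getD_tableauInsert, ih, List.count_append,
      List.count_singleton, beq_iff_eq, eq_comm (a := k)]

theorem flatten_insertWord_perm (l : List α) : (insertWord l).1.flatten.Perm l := by
  induction l using List.reverseRecOn with
  | nil => simp [insertWord]
  | append_singleton l x ih =>
    rw [insertWord_concat]
    exact (flatten_tableauInsert_perm _ _).trans
      ((ih.cons x).trans (List.perm_append_singleton x l).symm)

theorem insertWord_injective : Function.Injective (insertWord (α := α)) := by
  intro l
  induction l using List.reverseRecOn with
  | nil =>
    intro l' h
    have := congrArg List.length (congrArg Prod.snd h)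
    rw [length_insertWord_snd, length_insertWord_snd] at this
    exact (List.length_eq_zero_iff.1 this.symm).symm
  | append_singleton l x ih =>
    intro l' h
    rcases List.eq_nil_or_concat' l' with rfl | ⟨l', x', rfl⟩
    · have := congrArg List.length (congrArg Prod.snd h)
      simp [length_insertWord_snd] at this
    · rw [insertWord_concat, insertWord_concat, Prod.mk.injEq] at h
      obtain ⟨h1, h2⟩ := List.append_inj' h.2 rfl
      obtain ⟨rfl, h3⟩ := tableauInsert_injective (isTableau_insertWord l)
        (isTableau_insertWord l') (Prod.ext h.1 (by simpa using h2))
      rw [ih (Prod.ext h3 h1)]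

/-- Lattice words: in every prefix, `i` occurs at least as often as `i + 1`. -/
def IsLatticeWord (ρ : List ℕ) : Prop :=
  ∀ m i, (ρ.take m).count (i + 1) ≤ (ρ.take m).count i

/-- The surjectivity part of the Robinson–Schensted–Knuth correspondence. -/
theorem exists_insertWord_eq {ρ : List ℕ} (hρ : IsLatticeWord ρ) {t : List (List α)}
    (ht : IsTableau t) (hlen : ∀ k, (t.getD k []).length = ρ.count k) :
    ∃ l, insertWord l = (t, ρ) := by
  induction ρ using List.reverseRecOn generalizing t with
  | nil =>
    refine ⟨[], ?_⟩
    cases t with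
    | nil => rfl
    | cons r t => exact absurd (List.length_eq_zero_iff.1 (by simpa using hlen 0)) ht.1
  | append_singleton ρ i ih =>
    have hi := hρ ρ.length i
    simp only [List.take_left'] at hi
    obtain ⟨x, s, hs, e⟩ := exists_tableauInsert_eq ht (i := i) (by
      rw [hlen, hlen]
      simp
      omega)
    obtain ⟨l, hl⟩ := ih (fun m j => by
      rcases le_total m ρ.length with h | h
      · simpa [List.take_append_of_le_length h] using hρ m j
      · simpa [List.take_of_length_le h] using hρ ρ.length j) hs (fun k => by
        have h1 := length_getD_tableauInsert x s k
        rw [e, hlen k] at h1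
        simp only [List.count_append, List.count_singleton, beq_iff_eq, eq_comm (a := i)] at h1
        omega)
    exact ⟨l ++ [x], by simp [insertWord_concat, hl, e]⟩

/-- The labels of row `i` in the recording tableau with row word `ρ`. -/
def rowLabels (ρ : List ℕ) (i : ℕ) : List ℕ :=
  ((List.range ρ.length).filter fun k => ρ[k]? = some i).map (· + 1)

theorem rowLabels_concat (ρ : List ℕ) (k i : ℕ) :
    rowLabels (ρ ++ [k]) i = rowLabels ρ i ++ if i = k then [ρ.length + 1] else [] := by
  have h : (List.range ρ.length).filter (fun j => (ρ ++ [k])[j]? = some i) =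
      (List.range ρ.length).filter fun j => ρ[j]? = some i :=
    List.filter_congr fun j hj => by
      rw [List.getElem?_append_left (List.mem_range.1 hj)]
  simp only [rowLabels, List.length_append, List.length_singleton, List.range_succ,
    List.filter_append, h, List.map_append]
  by_cases hik : i = k
  · simp [hik]
  · simp [hik, Ne.symm hik]

theorem mem_rowLabels {ρ : List ℕ} {i k : ℕ} :
    k ∈ rowLabels ρ i ↔ 1 ≤ k ∧ ρ[k - 1]? = some i := by
  simp only [rowLabels, List.mem_map, List.mem_filter, List.mem_range, decide_eq_true_eq]
  constructor
  · rintro ⟨k, ⟨-, h⟩, rfl⟩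
    exact ⟨by omega, h⟩
  · rintro ⟨h1, h2⟩
    exact ⟨k - 1, ⟨(List.getElem?_eq_some_iff.1 h2).1, h2⟩, by omega⟩

theorem pairwise_rowLabels (ρ : List ℕ) (i : ℕ) : (rowLabels ρ i).Pairwise (· < ·) := by
  rw [rowLabels, List.pairwise_map]
  exact (List.pairwise_lt_range.filter _).imp (by simp)

theorem length_rowLabels (ρ : List ℕ) (i : ℕ) : (rowLabels ρ i).length = ρ.count i := by
  induction ρ using List.reverseRecOn with
  | nil => simp [rowLabels]
  | append_singleton ρ k ih =>
    rw [rowLabels_concat, List.length_append, ih, List.count_append, List.count_singleton]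
    by_cases h : i = k
    · simp [h]
    · simp [h, Ne.symm h]

theorem appendToRow_getD {i : ℕ} (k : ℕ) {s : List (List ℕ)} (hi : i ≤ s.length) (j : ℕ) :
    (appendToRow i k s).getD j [] = s.getD j [] ++ if j = i then [k] else [] := by
  induction s generalizing i j with
  | nil =>
    obtain rfl : i = 0 := by simpa using hi
    cases j <;> simp [appendToRow]
  | cons r s ih =>
    cases i with
    | zero => cases j <;> simp [appendToRow]
    | succ i =>
      cases j with
      | zero => simp [appendToRow]
      | succ j => simpa [appendToRow] using ih (by simpa using hi) j

theorem length_appendToRow {i : ℕ} (k : ℕ) {s : List (List ℕ)} (hi : i ≤ s.length) :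
    (appendToRow i k s).length = max s.length (i + 1) := by
  induction s generalizing i with
  | nil =>
    obtain rfl : i = 0 := by simpa using hi
    simp [appendToRow]
  | cons r s ih =>
    cases i with
    | zero => simp [appendToRow]
    | succ i => simp [appendToRow, ih (by simpa using hi)]

theorem rsk_succ {w : ℕ} (v : Fin (w + 1) → α) :
    rsk v = rskStep (rsk fun i => v i.castSucc) (v (Fin.last w)) (w + 1) := by
  simp [rsk, List.finRange_succ_last, List.foldl_map]

theorem rsk_spec {w : ℕ} (v : Fin w → α) :
    (rsk v).1 = (insertWord (List.ofFn v)).1 ∧ (rsk v).2.length = (rsk v).1.length ∧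
      ∀ i, (rsk v).2.getD i [] = rowLabels (insertWord (List.ofFn v)).2 i := by
  induction w with
  | zero => simp [rsk, insertWord, rowLabels]
  | succ w ih =>
    obtain ⟨h1, h2, h3⟩ := ih fun i => v i.castSucc
    have hofn : List.ofFn v = (List.ofFn fun i => v i.castSucc) ++ [v (Fin.last w)] := by
      rw [List.ofFn_succ']
      simp
    have hle := tableauInsert_snd_le (v (Fin.last w)) (rsk fun i => v i.castSucc).1
    rw [rsk_succ, hofn, insertWord_concat]
    refine ⟨by simp [rskStep, h1], ?_, fun i => ?_⟩
    · simp only [rskStep]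
      rw [length_appendToRow _ (h2 ▸ hle), length_tableauInsert, h2]
    · simp only [rskStep]
      rw [appendToRow_getD _ (h2 ▸ hle), h3, rowLabels_concat, h1, length_insertWord_snd,
        List.length_ofFn]

theorem recordingTableau_eq {w : ℕ} (v : Fin w → α) (i j : ℕ) :
    recordingTableau v i j = (rowLabels (insertWord (List.ofFn v)).2 i).getD j 0 := by
  rw [recordingTableau, (rsk_spec v).2.2]

end Words

section RowWord

variable {μ : YoungDiagram}

/-- `ρ` is the row word of the standard tableau `Q`: its `k`-th letter is the row of `Q` that
contains `k`. -/
def IsRowWord (Q : StandardYoungTableau μ) (ρ : List ℕ) : Prop :=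
  ρ.length = μ.card ∧ ∀ i j, (i, j) ∈ μ → ρ[Q.entry i j - 1]? = some i

theorem StandardYoungTableau.entry_mem (Q : StandardYoungTableau μ) {i j : ℕ} (h : (i, j) ∈ μ) :
    1 ≤ Q.entry i j ∧ Q.entry i j ≤ μ.card :=
  Q.bijOn'.mapsTo (x := (i, j)) (by simpa using h)

theorem StandardYoungTableau.exists_entry_eq (Q : StandardYoungTableau μ) {k : ℕ}
    (hk : k < μ.card) : ∃ i j, (i, j) ∈ μ ∧ Q.entry i j = k + 1 := by
  obtain ⟨⟨i, j⟩, h, e⟩ := Q.bijOn'.surjOn (a := k + 1) ⟨by omega, by omega⟩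
  exact ⟨i, j, by simpa using h, e⟩

theorem StandardYoungTableau.entry_injOn (Q : StandardYoungTableau μ) {i j i' j' : ℕ}
    (h : (i, j) ∈ μ) (h' : (i', j') ∈ μ) (e : Q.entry i j = Q.entry i' j') : i = i' ∧ j = j' := by
  have := Q.bijOn'.injOn (x₁ := (i, j)) (by simpa using h) (x₂ := (i', j')) (by simpa using h') e
  exact Prod.mk.inj this

theorem exists_isRowWord (Q : StandardYoungTableau μ) : ∃ ρ, IsRowWord Q ρ := by
  choose f g hf hg using fun k : Fin μ.card => Q.exists_entry_eq k.2
  refine ⟨List.ofFn f, by simp, fun i j h => ?_⟩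
  have hb := Q.entry_mem h
  have hk : Q.entry i j - 1 < μ.card := by omega
  have := (Q.entry_injOn (hf ⟨_, hk⟩) h (by rw [hg]; exact Nat.sub_add_cancel hb.1)).1
  rw [List.getElem?_ofFn, dif_pos hk, this]

theorem IsRowWord.eq {Q : StandardYoungTableau μ} {ρ ρ' : List ℕ} (h : IsRowWord Q ρ)
    (h' : IsRowWord Q ρ') : ρ = ρ' := by
  refine List.ext_getElem? fun k => ?_
  rcases lt_or_ge k μ.card with hk | hk
  · obtain ⟨i, j, hc, e⟩ := Q.exists_entry_eq hk
    have h1 := h.2 i j hc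
    have h2 := h'.2 i j hc
    rw [e] at h1 h2
    exact h1.trans h2.symm
  · rw [List.getElem?_eq_none (h.1 ▸ hk), List.getElem?_eq_none (h'.1 ▸ hk)]

theorem IsRowWord.rowLabels_eq {Q : StandardYoungTableau μ} {ρ : List ℕ} (h : IsRowWord Q ρ)
    (i : ℕ) : rowLabels ρ i = (List.range (μ.rowLen i)).map (Q.entry i) := by
  have hs : ((List.range (μ.rowLen i)).map (Q.entry i)).Pairwise (· < ·) := by
    rw [List.pairwise_map, List.pairwise_iff_getElem]
    intro a b ha hb hab
    simp only [List.length_range, List.getElem_range] at ha hb ⊢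
    have hcb := YoungDiagram.mem_iff_lt_rowLen.2 hb
    have hca := YoungDiagram.mem_iff_lt_rowLen.2 ha
    refine lt_of_le_of_ne (Q.row_weak' hab hcb) fun e => hab.ne ?_
    exact (Q.entry_injOn hca hcb e).2
  -- Both lists are strictly increasing with the same entries.
  refine List.Perm.eq_of_pairwise (le := (· < ·)) (fun a b _ _ hab hba => (hab.asymm hba).elim)
    (pairwise_rowLabels ρ i) hs ?_
  refine (List.perm_ext_iff_of_nodup ((pairwise_rowLabels ρ i).imp ne_of_lt)
    (hs.imp ne_of_lt)).2 fun k => ?_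
  rw [mem_rowLabels]
  simp only [List.mem_map, List.mem_range]
  constructor
  · rintro ⟨h1, h2⟩
    have hk : k - 1 < μ.card := h.1 ▸ (List.getElem?_eq_some_iff.1 h2).1
    obtain ⟨i', j, hc, e⟩ := Q.exists_entry_eq hk
    have h3 := h.2 i' j hc
    rw [e, Nat.add_sub_cancel, h2] at h3
    cases h3
    exact ⟨j, YoungDiagram.mem_iff_lt_rowLen.1 hc, by omega⟩
  · rintro ⟨j, hj, rfl⟩
    have hc := YoungDiagram.mem_iff_lt_rowLen.2 hj
    exact ⟨(Q.entry_mem hc).1, h.2 i j hc⟩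

theorem IsRowWord.count_eq {Q : StandardYoungTableau μ} {ρ : List ℕ} (h : IsRowWord Q ρ)
    (i : ℕ) : ρ.count i = μ.rowLen i := by
  rw [← length_rowLabels, h.rowLabels_eq]
  simp

theorem rowLabels_take (ρ : List ℕ) (m i : ℕ) :
    rowLabels (ρ.take m) i = (rowLabels ρ i).filter (· ≤ m) := by
  refine List.Perm.eq_of_pairwise (le := (· < ·)) (fun a b _ _ hab hba => (hab.asymm hba).elim)
    (pairwise_rowLabels _ i) ((pairwise_rowLabels ρ i).filter _) ?_
  refine (List.perm_ext_iff_of_nodup ((pairwise_rowLabels _ i).imp ne_of_lt)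
    (((pairwise_rowLabels ρ i).filter _).imp ne_of_lt)).2 fun k => ?_
  simp only [mem_rowLabels, List.mem_filter, decide_eq_true_eq, List.getElem?_take]
  split_ifs with h
  · constructor
    · rintro ⟨h1, h2⟩; exact ⟨⟨h1, h2⟩, by omega⟩
    · rintro ⟨h1, -⟩; exact h1
  · constructor
    · rintro ⟨-, h2⟩; cases h2
    · rintro ⟨⟨h1, -⟩, h2⟩; omega

theorem IsRowWord.isLatticeWord {Q : StandardYoungTableau μ} {ρ : List ℕ} (h : IsRowWord Q ρ) :
    IsLatticeWord ρ := by
  have key : ∀ m i, (ρ.take m).count i =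
      ((Finset.range (μ.rowLen i)).filter fun j => Q.entry i j ≤ m).card := by
    intro m i
    rw [← length_rowLabels, rowLabels_take, h.rowLabels_eq, List.filter_map, List.length_map]
    rfl
  intro m i
  rw [key, key]
  refine Finset.card_le_card fun j hj => ?_
  simp only [Finset.mem_filter, Finset.mem_range] at hj ⊢
  exact ⟨hj.1.trans_le (μ.rowLen_anti i (i + 1) (by omega)),
    (Q.col_strict' (Nat.lt_succ_self i) (YoungDiagram.mem_iff_lt_rowLen.2 hj.1)).le.trans hj.2⟩

theorem recordingTableau_eq_entry_iff {α : Type*} [LinearOrder α] (Q : StandardYoungTableau μ)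
    (v : Fin μ.card → α) :
    recordingTableau v = Q.entry ↔ IsRowWord Q (insertWord (List.ofFn v)).2 := by
  constructor
  · intro h
    refine ⟨by rw [length_insertWord_snd, List.length_ofFn], fun i j hc => ?_⟩
    have h1 := Q.entry_mem hc
    have h2 : (rowLabels (insertWord (List.ofFn v)).2 i).getD j 0 = Q.entry i j := by
      rw [← recordingTableau_eq, h]
    refine (mem_rowLabels.1 (?_ : Q.entry i j ∈ _)).2
    rcases lt_or_ge j (rowLabels (insertWord (List.ofFn v)).2 i).length with hj | hj
    · rw [← h2, List.getD_eq_getElem _ _ hj]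
      exact List.getElem_mem hj
    · rw [List.getD_eq_default _ _ hj] at h2
      omega
  · intro h
    funext i j
    rw [recordingTableau_eq, h.rowLabels_eq]
    rcases lt_or_ge j (μ.rowLen i) with hj | hj
    · rw [List.getD_eq_getElem _ _ (by simpa using hj)]
      simp
    · rw [List.getD_eq_default _ _ (by simpa using hj)]
      exact (Q.zeros' fun hc => absurd (YoungDiagram.mem_iff_lt_rowLen.1 hc) (not_lt.2 hj)).symm

end RowWord

/-! ### Lists of rows and semistandard tableaux -/

section Rows

variable {μ : YoungDiagram}

theorem isTableau_iff {α : Type*} [LinearOrder α] {t : List (List α)} :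
    IsTableau t ↔ ∀ k < t.length, t.getD k [] ≠ [] ∧ (t.getD k []).Pairwise (· ≤ ·) ∧
      Over (t.getD k []) (t.getD (k + 1) []) := by
  induction t with
  | nil => simp [IsTableau]
  | cons r t ih =>
    have h0 : t.getD 0 [] = t.headD [] := by cases t <;> rfl
    rw [IsTableau, ih, List.length_cons]
    constructor
    · rintro ⟨h1, h2, h3, h4⟩ (_ | k) hk
      · exact ⟨h1, h2, by rw [List.getD_cons_succ, h0]; exact h3⟩
      · exact h4 k (by omega)
    · intro h
      refine ⟨(h 0 (by omega)).1, (h 0 (by omega)).2.1, ?_, fun k hk => h (k + 1) (by omega)⟩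
      have := (h 0 (by omega)).2.2
      rwa [List.getD_cons_succ, h0] at this

theorem rowLen_pos_iff {k : ℕ} : 0 < μ.rowLen k ↔ k < μ.colLen 0 := by
  rw [← YoungDiagram.mem_iff_lt_rowLen, YoungDiagram.mem_iff_lt_colLen]

theorem col_strict_of_succ {e : ℕ → ℕ → ℕ} (h : ∀ i j, (i + 1, j) ∈ μ → e i j < e (i + 1) j)
    {i i' j : ℕ} (hi : i < i') (hc : (i', j) ∈ μ) : e i j < e i' j := by
  induction i', hi using Nat.le_induction with
  | base => exact h i j hc
  | succ i' hi ih => exact (ih (μ.up_left_mem (Nat.le_succ i') le_rfl hc)).trans (h i' j hc)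

theorem prod_cells {R : Type*} [CommMonoid R] (F : ℕ → ℕ → R) :
    ∏ c ∈ μ.cells, F c.1 c.2 =
      ∏ i ∈ Finset.range (μ.colLen 0), ∏ j ∈ Finset.range (μ.rowLen i), F i j := by
  refine Finset.prod_finset_product μ.cells _ (fun i => Finset.range (μ.rowLen i)) ?_
  rintro ⟨i, j⟩
  simp only [YoungDiagram.mem_cells, Finset.mem_range, YoungDiagram.mem_iff_lt_rowLen,
    ← rowLen_pos_iff]
  omega

/-- The rows of a semistandard tableau. -/
def toRows (T : SemistandardYoungTableau μ) : List (List ℕ) :=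
  (List.range (μ.colLen 0)).map fun i => (List.range (μ.rowLen i)).map (T i)

theorem length_toRows (T : SemistandardYoungTableau μ) : (toRows T).length = μ.colLen 0 := by
  simp [toRows]

theorem toRows_getD (T : SemistandardYoungTableau μ) (k : ℕ) :
    (toRows T).getD k [] = (List.range (μ.rowLen k)).map (T k) := by
  rcases lt_or_ge k (μ.colLen 0) with h | h
  · rw [List.getD_eq_getElem _ _ (by rwa [length_toRows])]
    simp [toRows]
  · rw [List.getD_eq_default _ _ (by rwa [length_toRows])]
    have : μ.rowLen k = 0 := by
      by_contra h0
      exact absurd (rowLen_pos_iff.1 (Nat.pos_of_ne_zero h0)) (not_lt.2 h)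
    simp [this]

theorem isTableau_toRows (T : SemistandardYoungTableau μ) : IsTableau (toRows T) := by
  rw [isTableau_iff]
  intro k hk
  rw [length_toRows] at hk
  rw [toRows_getD, toRows_getD]
  refine ⟨?_, ?_, ?_⟩
  · have := rowLen_pos_iff.2 hk
    simp
    omega
  · rw [List.pairwise_map, List.pairwise_iff_getElem]
    intro a b ha hb hab
    simp only [List.length_range, List.getElem_range] at ha hb ⊢
    exact T.row_weak hab (YoungDiagram.mem_iff_lt_rowLen.2 hb)
  · intro j b hb
    obtain ⟨hj, rfl⟩ := List.getElem?_eq_some_iff.1 hb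
    simp only [List.length_map, List.length_range] at hj
    have hj' := hj.trans_le (μ.rowLen_anti k (k + 1) (by omega))
    refine ⟨T k j, by simp [hj'], ?_⟩
    simpa using T.col_strict (Nat.lt_succ_self k) (YoungDiagram.mem_iff_lt_rowLen.2 hj)

theorem toRows_injective : Function.Injective (toRows (μ := μ)) := by
  intro T T' h
  ext i j
  by_cases hc : (i, j) ∈ μ
  · have hj := YoungDiagram.mem_iff_lt_rowLen.1 hc
    have := congrArg (fun t => (t.getD i [])[j]?) h
    simp only [toRows_getD] at this
    simpa [hj] using this
  · rw [T.zeros hc, T'.zeros hc]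

theorem exists_toRows_eq {t : List (List ℕ)} (ht : IsTableau t)
    (hlen : ∀ k, (t.getD k []).length = μ.rowLen k) :
    ∃ T : SemistandardYoungTableau μ, toRows T = t := by
  rw [isTableau_iff] at ht
  have hk : ∀ k, k < t.length ↔ 0 < μ.rowLen k := by
    intro k
    rw [← hlen, List.length_pos_iff]
    refine ⟨fun h => (ht k h).1, fun h => ?_⟩
    by_contra hk
    exact h (List.getD_eq_default _ _ (not_lt.1 hk))
  have hget : ∀ {i j}, (i, j) ∈ μ →
      (t.getD i [])[j]? = some ((t.getD i []).getD j 0) := by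
    intro i j hc
    have hj := YoungDiagram.mem_iff_lt_rowLen.1 hc
    have hj' : j < (t.getD i []).length := by rwa [hlen]
    rw [List.getD_eq_getElem _ 0 hj', List.getElem?_eq_getElem hj']
  have hlt : ∀ {i j}, (i, j) ∈ μ → i < t.length := fun hc =>
    (hk _).2 ((Nat.zero_le _).trans_lt (YoungDiagram.mem_iff_lt_rowLen.1 hc))
  refine ⟨⟨fun i j => (t.getD i []).getD j 0, ?_, ?_, ?_⟩, ?_⟩
  · intro i j j' hj hc
    exact getElem?_mono (ht i (hlt hc)).2.1 hj.le (hget (μ.up_left_mem le_rfl hj.le hc)) (hget hc)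
  · intro i₀ i₁ j₀ hi hc₀
    refine col_strict_of_succ (e := fun i j => (t.getD i []).getD j 0) (fun i j hc => ?_) hi hc₀
    have hc' := μ.up_left_mem (Nat.le_succ i) le_rfl hc
    obtain ⟨a, ha, hab⟩ := (ht i (hlt hc')).2.2 j _ (hget hc)
    rw [hget hc'] at ha
    cases ha
    exact hab
  · intro i j hc
    exact List.getD_eq_default _ _ (by
      rw [hlen]
      exact not_lt.1 fun h => hc (YoungDiagram.mem_iff_lt_rowLen.2 h))
  · have hl : t.length = μ.colLen 0 := by
      refine le_antisymm ?_ ?_ <;> by_contra! h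
      · exact absurd (rowLen_pos_iff.1 ((hk _).1 h)) (lt_irrefl _)
      · exact absurd ((hk _).2 (rowLen_pos_iff.2 h)) (lt_irrefl _)
    refine List.ext_getElem (by rw [length_toRows, hl]) fun i h1 h2 => ?_
    rw [← List.getD_eq_getElem _ [] h1, ← List.getD_eq_getElem _ [] h2, toRows_getD]
    refine List.ext_getElem (by rw [hlen, List.length_map, List.length_range]) fun j h3 h4 => ?_
    rw [← List.getD_eq_getElem _ 0 h4]
    simp only [List.getElem_map, List.getElem_range]
    rfl

theorem prod_map_flatten_toRows {R : Type*} [CommMonoid R] (T : SemistandardYoungTableau μ)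
    (f : ℕ → R) : ((toRows T).flatten.map f).prod = ∏ c ∈ μ.cells, f (T c.1 c.2) := by
  rw [prod_cells fun i j => f (T i j), List.map_flatten, List.prod_flatten, toRows, List.map_map,
    List.map_map]
  simp only [Function.comp_def, List.map_map]
  rfl

theorem forall_mem_flatten_toRows {T : SemistandardYoungTableau μ} {p : ℕ → Prop} :
    (∀ x ∈ (toRows T).flatten, p x) ↔ ∀ c : μ.cells, p (T c.1.1 c.1.2) := by
  simp only [toRows, List.mem_flatten, List.mem_map, List.mem_range]
  constructor
  · rintro h ⟨⟨i, j⟩, hc⟩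
    rw [YoungDiagram.mem_cells, YoungDiagram.mem_iff_lt_rowLen] at hc
    exact h _ ⟨_, ⟨i, rowLen_pos_iff.1 (by omega), rfl⟩,
      List.mem_map.2 ⟨j, List.mem_range.2 hc, rfl⟩⟩
  · rintro h x ⟨_, ⟨i, hi, rfl⟩, hx⟩
    obtain ⟨j, hj, rfl⟩ := List.mem_map.1 hx
    exact h ⟨(i, j), by
      rw [YoungDiagram.mem_cells, YoungDiagram.mem_iff_lt_rowLen]
      exact List.mem_range.1 hj⟩

/-- The words with a fixed recording tableau have the same content generating function as the
semistandard tableaux of its shape: the letters of a word are the entries of its insertion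
tableau. -/
theorem sum_words_eq_sum_tableaux {R : Type*} [CommSemiring R] (Q : StandardYoungTableau μ)
    (N : ℕ) (f : ℕ → R) [DecidablePred fun v : Fin μ.card → Fin N => recordingTableau v = Q.entry] :
    ∑ v : Fin μ.card → Fin N with recordingTableau v = Q.entry, ∏ i, f (v i) =
      ∑ T : SSYT μ N, ∏ c ∈ μ.cells, f (T.1 c.1 c.2) := by
  classical
  let P : (Fin μ.card → Fin N) → List (List ℕ) := fun v =>
    (insertWord (List.ofFn fun i => (v i : ℕ))).1
  have hrec : ∀ v : Fin μ.card → Fin N, recordingTableau v = Q.entry ↔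
      IsRowWord Q (insertWord (List.ofFn fun i => (v i : ℕ))).2 := fun v => by
    rw [← recordingTableau_eq_entry_iff, ← recordingTableau_comp Fin.val_strictMono v]
  have hinj : Set.InjOn P (Finset.univ.filter fun v : Fin μ.card → Fin N =>
      recordingTableau v = Q.entry) := by
    intro v hv v' hv' h
    simp only [Finset.coe_filter, Finset.mem_univ, true_and, Set.mem_ofPred_eq, hrec] at hv hv'
    have := List.ofFn_injective (insertWord_injective (Prod.ext h (hv.eq hv')))
    funext i
    exact Fin.ext (congrFun this i)
  have hinj' : Set.InjOn (fun T : SSYT μ N => toRows T.1) (Finset.univ : Finset (SSYT μ N)) :=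
    fun T _ T' _ h => Subtype.ext (toRows_injective h)
  have hP : ∀ v, ∏ i, f (v i) = ((P v).flatten.map f).prod := fun v => by
    rw [((flatten_insertWord_perm _).map f).prod_eq, List.map_ofFn, List.prod_ofFn]
    rfl
  simp only [hP, ← prod_map_flatten_toRows]
  rw [← Finset.sum_image (f := fun t : List (List ℕ) => (t.flatten.map f).prod) hinj,
    ← Finset.sum_image (f := fun t : List (List ℕ) => (t.flatten.map f).prod) hinj']
  congr 1
  ext t
  simp only [Finset.mem_image, Finset.mem_filter, Finset.mem_univ, true_and, hrec]
  constructor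
  · rintro ⟨v, hv, rfl⟩
    obtain ⟨T, hT⟩ := exists_toRows_eq (μ := μ) (isTableau_insertWord _)
      (fun k => (length_getD_insertWord _ k).trans (hv.count_eq k))
    refine ⟨⟨T, ?_⟩, hT⟩
    refine forall_mem_flatten_toRows (p := (· < N)).1 fun x hx => ?_
    rw [hT, (flatten_insertWord_perm _).mem_iff, List.mem_ofFn] at hx
    obtain ⟨i, rfl⟩ := hx
    exact (v i).2
  · rintro ⟨⟨T, hT⟩, rfl⟩
    obtain ⟨ρ, hρ⟩ := exists_isRowWord Q
    obtain ⟨l, hl⟩ := exists_insertWord_eq hρ.isLatticeWord (isTableau_toRows T)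
      (fun k => by rw [toRows_getD, hρ.count_eq]; simp)
    have hlen : l.length = μ.card := by rw [← length_insertWord_snd, hl, hρ.1]
    have hlt : ∀ x ∈ l, x < N := fun x hx =>
      forall_mem_flatten_toRows (p := (· < N)).2 hT x (by
        rw [← (flatten_insertWord_perm l).mem_iff, hl] at hx
        exact hx)
    have hofn : (List.ofFn fun i : Fin μ.card => l[i]'(by omega)) = l :=
      List.ext_getElem (by simp [hlen]) (by simp)
    refine ⟨fun i => ⟨l[i]'(by omega), hlt _ (List.getElem_mem _)⟩, ?_, ?_⟩
    · simp only [hofn, hl, hρ]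
    · simp only [P, hofn, hl]

end Rows

/-! ### Bender–Knuth involutions and the symmetry of Schur polynomials -/

section BenderKnuth

variable {μ : YoungDiagram}

/-- The number of entries smaller than `k` in row `i`. -/
def numBelow (T : SemistandardYoungTableau μ) (k i : ℕ) : ℕ :=
  ((Finset.range (μ.rowLen i)).filter fun j => T i j < k).card

theorem lt_numBelow_iff (T : SemistandardYoungTableau μ) {k i j : ℕ} (hc : (i, j) ∈ μ) :
    j < numBelow T k i ↔ T i j < k := by
  have hj := YoungDiagram.mem_iff_lt_rowLen.1 hc
  constructor
  · intro h
    by_contra! hk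
    refine absurd (Finset.card_le_card (t := Finset.range j) fun j' hj' => ?_)
      (not_le.2 (by simpa [numBelow] using h))
    simp only [Finset.mem_filter, Finset.mem_range] at hj' ⊢
    by_contra! hle
    have := T.row_weak_of_le hle (YoungDiagram.mem_iff_lt_rowLen.2 hj'.1)
    omega
  · intro h
    have : (Finset.range (j + 1)).card ≤ numBelow T k i :=
      Finset.card_le_card fun j' hj' => by
        simp only [Finset.mem_filter, Finset.mem_range] at hj' ⊢
        exact ⟨by omega, (T.row_weak_of_le (by omega) hc).trans_lt h⟩
    simpa using this

theorem numBelow_eq {T : SemistandardYoungTableau μ} {k i b : ℕ} (hb : b ≤ μ.rowLen i)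
    (h : ∀ j < μ.rowLen i, T i j < k ↔ j < b) : numBelow T k i = b := by
  rw [numBelow, ← Finset.card_range b]
  congr 1
  ext j
  simp only [Finset.mem_filter, Finset.mem_range]
  exact ⟨fun hj => (h j hj.1).1 hj.2, fun hj => ⟨by omega, (h j (by omega)).2 hj⟩⟩

theorem numBelow_le_rowLen (T : SemistandardYoungTableau μ) (k i : ℕ) :
    numBelow T k i ≤ μ.rowLen i :=
  (Finset.card_filter_le _ _).trans (by simp)

theorem numBelow_mono (T : SemistandardYoungTableau μ) {k k' : ℕ} (hk : k ≤ k') (i : ℕ) :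
    numBelow T k i ≤ numBelow T k' i :=
  Finset.card_le_card fun j hj => by
    simp only [Finset.mem_filter] at hj ⊢
    exact ⟨hj.1, by omega⟩

theorem numBelow_succ_row_le (T : SemistandardYoungTableau μ) (k i : ℕ) :
    numBelow T (k + 1) (i + 1) ≤ numBelow T k i :=
  Finset.card_le_card fun j hj => by
    simp only [Finset.mem_filter, Finset.mem_range] at hj ⊢
    have := T.col_strict (Nat.lt_add_one i) (YoungDiagram.mem_iff_lt_rowLen.2 hj.1)
    have := μ.rowLen_anti i (i + 1) (by omega)
    omega

/-- Given row by row the numbers `a i` and `b i` of entries smaller than `k` and `k + 2`, this is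
the least possible number of entries smaller than `k + 1` in row `i`. -/
def toggleMin (a b : ℕ → ℕ) (i : ℕ) : ℕ := max (a i) (b (i + 1))

/-- Given row by row the numbers `a i` and `b i` of entries smaller than `k` and `k + 2`, this is
the greatest possible number of entries smaller than `k + 1` in row `i`. -/
def toggleMax (a b : ℕ → ℕ) : ℕ → ℕ
  | 0 => b 0
  | i + 1 => min (b (i + 1)) (a i)

theorem sum_toggleMin_add_toggleMax (a b : ℕ → ℕ) (n : ℕ) :
    ∑ i ∈ Finset.range n, (toggleMin a b i + toggleMax a b i) + toggleMax a b n =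
      ∑ i ∈ Finset.range n, (a i + b i) + b n := by
  induction n with
  | zero => simp [toggleMax]
  | succ n ih =>
    rw [Finset.sum_range_succ, Finset.sum_range_succ]
    simp only [toggleMin, toggleMax] at ih ⊢
    omega

/-- The number of entries smaller than `k + 1` in row `i` after the Bender–Knuth involution that
exchanges `k` and `k + 1`: the possible numbers form an interval, which is reflected. -/
def toggled (T : SemistandardYoungTableau μ) (k i : ℕ) : ℕ :=
  toggleMin (numBelow T k) (numBelow T (k + 2)) i +
    toggleMax (numBelow T k) (numBelow T (k + 2)) i - numBelow T (k + 1) i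

theorem numBelow_mem_toggle (T : SemistandardYoungTableau μ) (k i : ℕ) :
    toggleMin (numBelow T k) (numBelow T (k + 2)) i ≤ numBelow T (k + 1) i ∧
      numBelow T (k + 1) i ≤ toggleMax (numBelow T k) (numBelow T (k + 2)) i := by
  have h1 := numBelow_mono T (Nat.le_add_right k 1) i
  have h2 := numBelow_mono T (Nat.le_add_right (k + 1) 1) i
  have h3 := numBelow_succ_row_le T (k + 1) i
  refine ⟨max_le h1 h3, ?_⟩
  cases i with
  | zero => exact h2
  | succ i => exact le_min h2 (numBelow_succ_row_le T k i)

theorem toggled_bounds (T : SemistandardYoungTableau μ) (k i : ℕ) :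
    numBelow T k i ≤ toggled T k i ∧ toggled T k i ≤ numBelow T (k + 2) i ∧
      numBelow T (k + 2) (i + 1) ≤ toggled T k i ∧ toggled T k (i + 1) ≤ numBelow T k i := by
  have h := numBelow_mem_toggle T k i
  have h' := numBelow_mem_toggle T k (i + 1)
  have hm : toggleMax (numBelow T k) (numBelow T (k + 2)) i ≤ numBelow T (k + 2) i := by
    cases i with
    | zero => exact le_rfl
    | succ i => exact min_le_left _ _
  have hm' : toggleMax (numBelow T k) (numBelow T (k + 2)) (i + 1) ≤ numBelow T k i :=
    min_le_right _ _
  have hl : numBelow T k i ≤ toggleMin (numBelow T k) (numBelow T (k + 2)) i := le_max_left _ _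
  have hl' : numBelow T (k + 2) (i + 1) ≤ toggleMin (numBelow T k) (numBelow T (k + 2)) i :=
    le_max_right _ _
  simp only [toggled]
  omega

/-- The filling obtained by the Bender–Knuth involution: in each row, the cells holding `k` or
`k + 1` are refilled so that `toggled T k i` entries of row `i` are smaller than `k + 1`. -/
def benderKnuthEntry (T : SemistandardYoungTableau μ) (k i j : ℕ) : ℕ :=
  if numBelow T k i ≤ j ∧ j < numBelow T (k + 2) i then
    if j < toggled T k i then k else k + 1
  else T i j

/-- The Bender–Knuth involution, which exchanges the numbers of entries `k` and `k + 1`. -/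
def benderKnuth (k : ℕ) (T : SemistandardYoungTableau μ) : SemistandardYoungTableau μ where
  entry := benderKnuthEntry T k
  row_weak' := by
    intro i j j' hj hc
    have hc' := μ.up_left_mem le_rfl hj.le hc
    have h1 := lt_numBelow_iff T (k := k) hc
    have h2 := lt_numBelow_iff T (k := k + 2) hc
    have h1' := lt_numBelow_iff T (k := k) hc'
    have h2' := lt_numBelow_iff T (k := k + 2) hc'
    have h3 := T.row_weak hj hc
    simp only [benderKnuthEntry]
    split_ifs <;> omega
  col_strict' := by
    intro i₀ i₁ j₀ hi hc₀
    refine col_strict_of_succ (e := benderKnuthEntry T k) (fun i j hc => ?_) hi hc₀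
    have hc' := μ.up_left_mem (Nat.le_add_right i 1) le_rfl hc
    have h1 := lt_numBelow_iff T (k := k) hc
    have h2 := lt_numBelow_iff T (k := k + 2) hc
    have h1' := lt_numBelow_iff T (k := k) hc'
    have h2' := lt_numBelow_iff T (k := k + 2) hc'
    have h3 := T.col_strict (Nat.lt_add_one i) hc
    have h4 := toggled_bounds T k i
    simp only [benderKnuthEntry]
    split_ifs <;> omega
  zeros' := by
    intro i j hc
    have hj : μ.rowLen i ≤ j := not_lt.1 fun h => hc (YoungDiagram.mem_iff_lt_rowLen.2 h)
    have := numBelow_le_rowLen T (k + 2) i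
    rw [benderKnuthEntry, if_neg (by omega), T.zeros hc]

theorem benderKnuth_apply (k : ℕ) (T : SemistandardYoungTableau μ) (i j : ℕ) :
    benderKnuth k T i j = benderKnuthEntry T k i j := rfl

theorem numBelow_benderKnuth (k : ℕ) (T : SemistandardYoungTableau μ) (i : ℕ) :
    numBelow (benderKnuth k T) k i = numBelow T k i ∧
    numBelow (benderKnuth k T) (k + 1) i = toggled T k i ∧
    numBelow (benderKnuth k T) (k + 2) i = numBelow T (k + 2) i := by
  have h4 := toggled_bounds T k i
  have h5 := numBelow_le_rowLen T (k + 2) i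
  refine ⟨numBelow_eq (by omega) fun j hj => ?_, numBelow_eq (by omega) fun j hj => ?_,
    numBelow_eq (by omega) fun j hj => ?_⟩ <;>
  · have hc := YoungDiagram.mem_iff_lt_rowLen.2 hj
    have h1 := lt_numBelow_iff T (k := k) hc
    have h2 := lt_numBelow_iff T (k := k + 2) hc
    rw [benderKnuth_apply, benderKnuthEntry]
    split_ifs <;> omega

theorem toggled_benderKnuth (k : ℕ) (T : SemistandardYoungTableau μ) (i : ℕ) :
    toggled (benderKnuth k T) k i = numBelow T (k + 1) i := by
  have h1 : numBelow (benderKnuth k T) k = numBelow T k :=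
    funext fun i => (numBelow_benderKnuth k T i).1
  have h2 : numBelow (benderKnuth k T) (k + 2) = numBelow T (k + 2) :=
    funext fun i => (numBelow_benderKnuth k T i).2.2
  have h3 := numBelow_mem_toggle T k i
  rw [toggled, h1, h2, (numBelow_benderKnuth k T i).2.1, toggled]
  omega

theorem benderKnuth_involutive (k : ℕ) :
    Function.Involutive (benderKnuth k : SemistandardYoungTableau μ → _) := by
  intro T
  ext i j
  by_cases hc : (i, j) ∈ μ
  · have h0 := lt_numBelow_iff T (k := k) hc
    have h1 := lt_numBelow_iff T (k := k + 1) hc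
    have h2 := lt_numBelow_iff T (k := k + 2) hc
    rw [benderKnuth_apply, benderKnuthEntry, toggled_benderKnuth, (numBelow_benderKnuth k T i).1,
      (numBelow_benderKnuth k T i).2.2, benderKnuth_apply, benderKnuthEntry]
    split_ifs <;> omega
  · rw [SemistandardYoungTableau.zeros _ hc, T.zeros hc]

theorem benderKnuth_lt {k N : ℕ} (hk : k + 1 < N) {T : SemistandardYoungTableau μ}
    (hT : ∀ c : μ.cells, T c.1.1 c.1.2 < N) (c : μ.cells) :
    benderKnuth k T c.1.1 c.1.2 < N := by
  have := hT c
  rw [benderKnuth_apply, benderKnuthEntry]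
  split_ifs <;> omega

theorem prod_range_eq_of_band {R : Type*} [CommMonoid R] {F g : ℕ → R} {a m b r : ℕ} {x y : R}
    (ham : a ≤ m) (hmb : m ≤ b) (hbr : b ≤ r) (h1 : ∀ j < a, F j = g j)
    (h2 : ∀ j, a ≤ j → j < m → F j = x) (h3 : ∀ j, m ≤ j → j < b → F j = y)
    (h4 : ∀ j, b ≤ j → j < r → F j = g j) :
    ∏ j ∈ Finset.range r, F j =
      (∏ j ∈ Finset.range a, g j) * (∏ j ∈ Finset.Ico b r, g j) * (x ^ (m - a) * y ^ (b - m)) := by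
  rw [Finset.range_eq_Ico, ← Finset.prod_Ico_consecutive F (Nat.zero_le b) hbr,
    ← Finset.prod_Ico_consecutive F (Nat.zero_le m) hmb,
    ← Finset.prod_Ico_consecutive F (Nat.zero_le a) ham]
  have e1 : ∏ j ∈ Finset.Ico 0 a, F j = ∏ j ∈ Finset.Ico 0 a, g j :=
    Finset.prod_congr rfl fun j hj => h1 j (Finset.mem_Ico.1 hj).2
  have e2 : ∏ j ∈ Finset.Ico a m, F j = x ^ (m - a) := by
    rw [Finset.prod_congr rfl fun j hj => h2 j (Finset.mem_Ico.1 hj).1 (Finset.mem_Ico.1 hj).2]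
    simp
  have e3 : ∏ j ∈ Finset.Ico m b, F j = y ^ (b - m) := by
    rw [Finset.prod_congr rfl fun j hj => h3 j (Finset.mem_Ico.1 hj).1 (Finset.mem_Ico.1 hj).2]
    simp
  have e4 : ∏ j ∈ Finset.Ico b r, F j = ∏ j ∈ Finset.Ico b r, g j :=
    Finset.prod_congr rfl fun j hj => h4 j (Finset.mem_Ico.1 hj).1 (Finset.mem_Ico.1 hj).2
  rw [e1, e2, e3, e4, Finset.range_eq_Ico, mul_assoc, mul_assoc, mul_assoc]
  congr 1
  rw [← mul_assoc, mul_comm]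

theorem sum_toggled_add_sum_numBelow (k : ℕ) (T : SemistandardYoungTableau μ) :
    ∑ i ∈ Finset.range (μ.colLen 0), (toggled T k i + numBelow T (k + 1) i) =
      ∑ i ∈ Finset.range (μ.colLen 0), (numBelow T k i + numBelow T (k + 2) i) := by
  have h := sum_toggleMin_add_toggleMax (numBelow T k) (numBelow T (k + 2)) (μ.colLen 0)
  have h0 : μ.rowLen (μ.colLen 0) = 0 := by
    by_contra h0
    exact absurd (rowLen_pos_iff.1 (Nat.pos_of_ne_zero h0)) (lt_irrefl _)
  have hb : numBelow T (k + 2) (μ.colLen 0) = 0 := by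
    have := numBelow_le_rowLen T (k + 2) (μ.colLen 0)
    omega
  have hm : toggleMax (numBelow T k) (numBelow T (k + 2)) (μ.colLen 0) = 0 := by
    generalize μ.colLen 0 = n at hb
    cases n with
    | zero => exact hb
    | succ n => simp [toggleMax, hb]
  rw [hb, hm, add_zero, add_zero] at h
  rw [← h]
  refine Finset.sum_congr rfl fun i _ => ?_
  have := numBelow_mem_toggle T k i
  simp only [toggled]
  omega

/-- The Bender–Knuth involution exchanges the numbers of entries `k` and `k + 1`. -/
theorem prod_benderKnuth {R : Type*} [CommMonoid R] (k : ℕ) (T : SemistandardYoungTableau μ)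
    (f : ℕ → R) : ∏ c ∈ μ.cells, f (benderKnuth k T c.1 c.2) =
      ∏ c ∈ μ.cells, f (Equiv.swap k (k + 1) (T c.1 c.2)) := by
  rw [prod_cells fun i j => f (benderKnuth k T i j),
    prod_cells fun i j => f (Equiv.swap k (k + 1) (T i j))]
  let g : ℕ → R := fun i => (∏ j ∈ Finset.range (numBelow T k i), f (T i j)) *
    ∏ j ∈ Finset.Ico (numBelow T (k + 2) i) (μ.rowLen i), f (T i j)
  have hL : ∀ i, ∏ j ∈ Finset.range (μ.rowLen i), f (benderKnuth k T i j) =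
      g i * (f k ^ (toggled T k i - numBelow T k i) *
        f (k + 1) ^ (numBelow T (k + 2) i - toggled T k i)) := by
    intro i
    have hb := toggled_bounds T k i
    refine prod_range_eq_of_band hb.1 hb.2.1 (numBelow_le_rowLen T _ i) (fun j hj => ?_)
      (fun j h1 h2 => ?_) (fun j h1 h2 => ?_) (fun j h1 h2 => ?_) <;>
    rw [benderKnuth_apply, benderKnuthEntry]
    · rw [if_neg (by omega)]
    · rw [if_pos (by omega), if_pos h2]
    · rw [if_pos (by omega), if_neg (by omega)]
    · rw [if_neg (by omega)]
  have hR : ∀ i, ∏ j ∈ Finset.range (μ.rowLen i), f (Equiv.swap k (k + 1) (T i j)) =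
      g i * (f (k + 1) ^ (numBelow T (k + 1) i - numBelow T k i) *
        f k ^ (numBelow T (k + 2) i - numBelow T (k + 1) i)) := by
    intro i
    have h1 := numBelow_mono T (Nat.le_add_right k 1) i
    have h2 := numBelow_mono T (show k + 1 ≤ k + 2 by omega) i
    have h3 := numBelow_le_rowLen T (k + 2) i
    have hlt : ∀ (n : ℕ) {j : ℕ}, j < μ.rowLen i → (j < numBelow T n i ↔ T i j < n) :=
      fun n _ hj => lt_numBelow_iff T (YoungDiagram.mem_iff_lt_rowLen.2 hj)
    refine prod_range_eq_of_band h1 h2 h3 (fun j hj => ?_)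
      (fun j h1 h2 => ?_) (fun j h1 h2 => ?_) (fun j h1 h2 => ?_)
    · have := hlt k (j := j) (by omega)
      rw [Equiv.swap_apply_of_ne_of_ne (by omega) (by omega)]
    · have := hlt k (j := j) (by omega)
      have := hlt (k + 1) (j := j) (by omega)
      rw [show T i j = k by omega, Equiv.swap_apply_left]
    · have := hlt (k + 2) (j := j) (by omega)
      have := hlt (k + 1) (j := j) (by omega)
      rw [show T i j = k + 1 by omega, Equiv.swap_apply_right]
    · have := hlt (k + 2) (j := j) (by omega)
      rw [Equiv.swap_apply_of_ne_of_ne (by omega) (by omega)]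
  simp only [hL, hR, Finset.prod_mul_distrib, Finset.prod_pow_eq_pow_sum]
  -- The exponents agree because the sizes of the reflected intervals add up.
  have key := sum_toggled_add_sum_numBelow k T
  simp only [Finset.sum_add_distrib] at key
  have hsub : ∀ u v : ℕ → ℕ, (∀ i, u i ≤ v i) → ∑ i ∈ Finset.range (μ.colLen 0), (v i - u i) =
      ∑ i ∈ Finset.range (μ.colLen 0), v i - ∑ i ∈ Finset.range (μ.colLen 0), u i :=
    fun u v huv => Finset.sum_tsub_distrib _ fun i _ => huv i
  have hle : ∀ u v : ℕ → ℕ, (∀ i, u i ≤ v i) → ∑ i ∈ Finset.range (μ.colLen 0), u i ≤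
      ∑ i ∈ Finset.range (μ.colLen 0), v i := fun u v huv => Finset.sum_le_sum fun i _ => huv i
  have ham : ∀ i, numBelow T k i ≤ numBelow T (k + 1) i := fun i =>
    numBelow_mono T (Nat.le_add_right k 1) i
  have hmb : ∀ i, numBelow T (k + 1) i ≤ numBelow T (k + 2) i := fun i =>
    numBelow_mono T (Nat.le_add_right (k + 1) 1) i
  have hat : ∀ i, numBelow T k i ≤ toggled T k i := fun i => (toggled_bounds T k i).1
  have htb : ∀ i, toggled T k i ≤ numBelow T (k + 2) i := fun i => (toggled_bounds T k i).2.1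
  have e1 : ∑ i ∈ Finset.range (μ.colLen 0), (toggled T k i - numBelow T k i) =
      ∑ i ∈ Finset.range (μ.colLen 0), (numBelow T (k + 2) i - numBelow T (k + 1) i) := by
    rw [hsub _ _ hat, hsub _ _ hmb]
    have := hle _ _ hat
    have := hle _ _ hmb
    omega
  have e2 : ∑ i ∈ Finset.range (μ.colLen 0), (numBelow T (k + 2) i - toggled T k i) =
      ∑ i ∈ Finset.range (μ.colLen 0), (numBelow T (k + 1) i - numBelow T k i) := by
    rw [hsub _ _ htb, hsub _ _ ham]
    have := hle _ _ htb
    have := hle _ _ ham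
    omega
  rw [e1, e2, mul_comm (f k ^ _)]

theorem aeval_schurPoly {R : Type*} [CommRing R] [Algebra ℤ R] {N : ℕ} (g : Fin N → R) (f : ℕ → R)
    (hf : ∀ i : Fin N, f i = g i) : MvPolynomial.aeval g (schurPoly μ N) =
      ∑ T : SSYT μ N, ∏ c ∈ μ.cells, f (T.1 c.1 c.2) := by
  rw [schurPoly, map_sum]
  refine Finset.sum_congr rfl fun T _ => ?_
  rw [weightMonomial, map_prod, ← Finset.prod_coe_sort μ.cells]
  exact Finset.prod_congr rfl fun c _ => by rw [MvPolynomial.aeval_X, ← hf]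

/-- Schur polynomials are symmetric. -/
theorem aeval_comp_schurPoly {R : Type*} [CommRing R] [Algebra ℤ R] {N : ℕ} (g : Fin N → R)
    (σ : Equiv.Perm (Fin N)) :
    MvPolynomial.aeval (g ∘ σ) (schurPoly μ N) = MvPolynomial.aeval g (schurPoly μ N) := by
  cases N with
  | zero => rw [Subsingleton.elim (g ∘ σ) g]
  | succ n =>
    have hσ : σ ∈ Submonoid.closure (Set.range fun i : Fin n => Equiv.swap i.castSucc i.succ) := by
      rw [Equiv.Perm.mclosure_swap_castSucc_succ]
      trivial
    induction hσ using Submonoid.closure_induction generalizing g with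
    | one => rfl
    | mul σ τ _ _ hσ hτ => rw [Equiv.Perm.coe_mul, ← Function.comp_assoc, hτ, hσ]
    | mem σ hσ =>
      obtain ⟨k, rfl⟩ := hσ
      let f : ℕ → R := fun m => if h : m < n + 1 then g ⟨m, h⟩ else 0
      have hf : ∀ i : Fin (n + 1), f i = g i := fun i => dif_pos i.2
      have hs : ∀ i : Fin (n + 1), Equiv.swap (k : ℕ) (k + 1) i =
          (Equiv.swap k.castSucc k.succ i : Fin (n + 1)) := fun i => by
        simp only [Equiv.swap_apply_def, Fin.ext_iff, Fin.val_castSucc, Fin.val_succ]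
        split_ifs <;> rfl
      rw [aeval_schurPoly g f hf, aeval_schurPoly (g ∘ Equiv.swap k.castSucc k.succ)
        (fun m => f (Equiv.swap (k : ℕ) (k + 1) m)) fun i => by rw [hs, hf]; rfl]
      let e : Equiv.Perm (SSYT μ (n + 1)) := Function.Involutive.toPerm
        (fun T => ⟨benderKnuth k T.1, benderKnuth_lt (by have := k.2; omega) T.2⟩)
        fun T => Subtype.ext (benderKnuth_involutive _ T.1)
      rw [← Equiv.sum_comp e fun T : SSYT μ (n + 1) => ∏ c ∈ μ.cells, f (T.1 c.1 c.2)]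
      exact Finset.sum_congr rfl fun T _ => (prod_benderKnuth k T.1 f).symm

end BenderKnuth

/-! ### Expansion of symmetric Laurent polynomials in `q`-integers -/

section Expansion

open LaurentPolynomial

theorem coeff_T_sub_T_mul (f : ℤ[T;T⁻¹]) (n : ℤ) :
    ((T 1 - T (-1)) * f).coeff n = f.coeff (n - 1) - f.coeff (n + 1) := by
  have h : ∀ m : ℤ, (T m * f).coeff n = f.coeff (n - m) := fun m => by
    rw [T, AddMonoidAlgebra.coeff_single_mul_eq_mul_coeff (n - m) (fun k _ => by omega), one_mul]
  rw [sub_mul, AddMonoidAlgebra.coeff_sub, Finsupp.sub_apply, h, h, sub_neg_eq_add]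

theorem T_one_sub_T_ne_zero : (T 1 - T (-1) : ℤ[T;T⁻¹]) ≠ 0 := by
  intro h
  have := congrArg (fun f : ℤ[T;T⁻¹] => f.coeff 1) h
  simp at this

theorem coeff_sum_C_mul_T (a : ℕ →₀ ℤ) (n : ℤ) :
    (a.sum fun k c => C c * T (k : ℤ) : ℤ[T;T⁻¹]).coeff n = if 0 ≤ n then a n.toNat else 0 := by
  have h : ∀ k : ℕ, (C (a k) * T (k : ℤ) : ℤ[T;T⁻¹]).coeff n = if (k : ℤ) = n then a k else 0 := by
    intro k
    rw [← single_eq_C_mul_T, AddMonoidAlgebra.coeff_single, Finsupp.single_apply]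
  rw [Finsupp.sum, AddMonoidAlgebra.coeff_sum, Finsupp.finsetSum_apply]
  simp only [h]
  split_ifs with hn
  · lift n to ℕ using hn
    simpa using fun h => h.symm
  · exact Finset.sum_eq_zero fun k _ => if_neg (by omega)

theorem IsQIntExpansion.mul_eq {f : ℤ[T;T⁻¹]} {a : ℕ →₀ ℤ} (h : IsQIntExpansion f a) :
    (T 1 - T (-1)) * f = (a.sum fun k c => C c * T (k : ℤ)) -
      invert (a.sum fun k c => C c * T (k : ℤ)) := by
  rw [h.2, Finsupp.mul_sum, map_finsuppSum, ← Finsupp.sum_sub]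
  refine Finsupp.sum_congr fun k _ => ?_
  rw [mul_left_comm, qInt_spec, map_mul, invert_C, invert_T, mul_sub]

theorem IsQIntExpansion.coeff_mul {f : ℤ[T;T⁻¹]} {a : ℕ →₀ ℤ} (h : IsQIntExpansion f a) {n : ℤ}
    (hn : 0 ≤ n) : ((T 1 - T (-1)) * f).coeff n = a n.toNat := by
  rw [h.mul_eq, AddMonoidAlgebra.coeff_sub, Finsupp.sub_apply, invert_apply, coeff_sum_C_mul_T,
    coeff_sum_C_mul_T, if_pos hn]
  rcases hn.eq_or_lt with rfl | hn
  · simp [h.1]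
  · simp [hn]

theorem IsQIntExpansion.eq {f : ℤ[T;T⁻¹]} {a b : ℕ →₀ ℤ} (ha : IsQIntExpansion f a)
    (hb : IsQIntExpansion f b) : a = b := by
  ext n
  have h := (ha.coeff_mul (Int.natCast_nonneg n)).symm.trans (hb.coeff_mul (Int.natCast_nonneg n))
  simpa using h

/-- A Laurent polynomial that is invariant under `q ↦ q⁻¹` is an integral combination of
`q`-integers. -/
theorem exists_isQIntExpansion {f : ℤ[T;T⁻¹]} (hf : invert f = f) :
    ∃ a, IsQIntExpansion f a := by
  let g : ℤ[T;T⁻¹] := (T 1 - T (-1)) * f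
  have hg : ∀ n, g.coeff (-n) = -g.coeff n := fun n => by
    have hs : ∀ m, f.coeff (-m) = f.coeff m := fun m => by
      rw [← invert_apply, hf]
    simp only [g, coeff_T_sub_T_mul]
    rw [← hs (-n - 1), ← hs (-n + 1)]
    ring_nf
  have hg0 : g.coeff 0 = 0 := by
    have := hg 0
    rw [neg_zero] at this
    omega
  let a : ℕ →₀ ℤ := g.coeff.comapDomain (fun n : ℕ => (n : ℤ)) Nat.cast_injective.injOn
  have ha : ∀ n, a n = g.coeff n := fun n => rfl
  refine ⟨a, by rw [ha]; exact hg0, mul_left_cancel₀ T_one_sub_T_ne_zero ?_⟩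
  have e : (T 1 - T (-1)) * (a.sum fun k c => C c * qInt k) =
      (a.sum fun k c => C c * T (k : ℤ)) -
      invert (a.sum fun k c => C c * T (k : ℤ) : ℤ[T;T⁻¹]) := by
    exact IsQIntExpansion.mul_eq ⟨by rw [ha]; exact hg0, rfl⟩
  rw [e]
  ext n
  rw [AddMonoidAlgebra.coeff_sub, Finsupp.sub_apply, invert_apply, coeff_sum_C_mul_T,
    coeff_sum_C_mul_T, ha, ha]
  rcases lt_trichotomy n 0 with h | rfl | h
  · rw [if_neg (by omega), if_pos (by omega), Int.toNat_of_nonneg (by omega), hg]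
    simp [g]
  · simpa using hg0
  · rw [if_pos (by omega), if_neg (by omega), Int.toNat_of_nonneg (by omega)]
    simp [g]

/-- The positive part of `(q - q⁻¹) f` reads off the expansion of `f` in `q`-integers. -/
theorem IsQIntExpansion.positivePart_mul {f : ℤ[T;T⁻¹]} {a : ℕ →₀ ℤ} (h : IsQIntExpansion f a) :
    positivePart ((T 1 - T (-1)) * f) = a.sum fun k c => C c * T (k : ℤ) := by
  ext n
  rw [coeff_sum_C_mul_T, positivePart, AddMonoidAlgebra.coeff_ofCoeff, Finsupp.filter_apply]
  split_ifs with hn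
  · exact h.coeff_mul hn
  · rfl

end Expansion

/-! ### Plethysm with a one-row Schur function in two variables -/

section Plethysm

open LaurentPolynomial

theorem prod_T {ι : Type*} (s : Finset ι) (e : ι → ℤ) :
    ∏ i ∈ s, (T (e i) : ℤ[T;T⁻¹]) = T (∑ i ∈ s, e i) := by
  classical
  induction s using Finset.induction_on with
  | empty => simp
  | insert i s hi ih => rw [Finset.prod_insert hi, Finset.sum_insert hi, ih, T_add]

theorem mem_oneRow {h i j : ℕ} : (i, j) ∈ oneRow h ↔ i = 0 ∧ j < h := by
  rw [oneRow, YoungDiagram.mem_ofRowLens]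
  constructor
  · rintro ⟨hi, hj⟩
    obtain rfl : i = 0 := by simpa using hi
    exact ⟨rfl, by simpa using hj⟩
  · rintro ⟨rfl, hj⟩
    exact ⟨by simp, by simpa using hj⟩

theorem cells_oneRow (h : ℕ) : (oneRow h).cells = {0} ×ˢ Finset.range h := by
  ext ⟨i, j⟩
  simp only [YoungDiagram.mem_cells, mem_oneRow, Finset.mem_product, Finset.mem_singleton,
    Finset.mem_range]

/-- The tableau `0 ⋯ 0 1 ⋯ 1` with one row of length `h` and `a` entries `1`. -/
def twoLetterRow (h : ℕ) (a : Fin (h + 1)) : SSYT (oneRow h) 2 :=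
  ⟨{ entry := fun i j => if i = 0 ∧ h - a ≤ j ∧ j < h then 1 else 0
     row_weak' := by
       intro i j j' hj hc
       have := mem_oneRow.1 hc
       split_ifs <;> omega
     col_strict' := by
       intro i i' j hi hc
       have := mem_oneRow.1 hc
       omega
     zeros' := by
       intro i j hc
       rw [mem_oneRow] at hc
       exact if_neg fun h' => hc ⟨h'.1, h'.2.2⟩ }, by
    intro c
    change (if _ then _ else _) < 2
    split_ifs <;> omega⟩

theorem twoLetterRow_apply {h j : ℕ} (a : Fin (h + 1)) :
    (twoLetterRow h a).1 0 j = if h - a ≤ j ∧ j < h then 1 else 0 := by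
  change (if 0 = 0 ∧ h - a ≤ j ∧ j < h then 1 else 0) = _
  simp

theorem sum_twoLetterRow {h : ℕ} (a : Fin (h + 1)) :
    ∑ j ∈ Finset.range h, (twoLetterRow h a).1 0 j = a := by
  simp only [twoLetterRow_apply]
  rw [Finset.sum_boole]
  have : (Finset.range h).filter (fun j => h - a ≤ j ∧ j < h) = Finset.Ico (h - a) h := by
    ext j
    simp only [Finset.mem_filter, Finset.mem_range, Finset.mem_Ico]
    omega
  rw [this, Nat.card_Ico, Nat.cast_id]
  have := a.2
  omega

theorem twoLetterRow_bijective (h : ℕ) : Function.Bijective (twoLetterRow h) := by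
  constructor
  · intro a b hab
    have := congrArg (fun T : SSYT (oneRow h) 2 => ∑ j ∈ Finset.range h, T.1 0 j) hab
    simp only [sum_twoLetterRow] at this
    exact Fin.ext this
  · rintro ⟨T, hT⟩
    refine ⟨⟨h - numBelow T 1 0, by omega⟩, ?_⟩
    apply Subtype.ext
    ext i j
    by_cases hc : (i, j) ∈ oneRow h
    · obtain ⟨rfl, hj⟩ := mem_oneRow.1 hc
      have h1 := lt_numBelow_iff T (k := 1) hc
      have h2 : T 0 j < 2 := hT ⟨(0, j), (YoungDiagram.mem_cells _).2 hc⟩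
      have h3 : numBelow T 1 0 ≤ h := by
        by_contra! hlt
        have := numBelow_le_rowLen T 1 0
        exact absurd (mem_oneRow.1 (YoungDiagram.mem_iff_lt_rowLen.2 (hlt.trans_le this))).2
          (lt_irrefl _)
      rw [twoLetterRow_apply]
      split_ifs with hif <;> simp only at hif ⊢ <;> omega
    · rw [SemistandardYoungTableau.zeros _ hc, T.zeros hc]

theorem aeval_weightMonomial_twoLetterRow (h : ℕ) (a : Fin (h + 1)) :
    MvPolynomial.aeval ![T (-1), (T 1 : ℤ[T;T⁻¹])] (weightMonomial (twoLetterRow h a)) =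
      T (2 * (a : ℤ) - h) := by
  have hT : ∀ x : Fin 2, (![T (-1), T 1] x : ℤ[T;T⁻¹]) = T (2 * (x : ℤ) - 1) := by
    intro x
    fin_cases x <;> simp
  rw [weightMonomial, map_prod]
  simp only [MvPolynomial.aeval_X, hT]
  rw [Finset.prod_coe_sort (oneRow h).cells
    (fun c => (T (2 * ((twoLetterRow h a).1 c.1 c.2 : ℤ) - 1) : ℤ[T;T⁻¹])),
    Finset.prod_congr (cells_oneRow h) fun _ _ => rfl,
    Finset.prod_product, Finset.prod_singleton, prod_T, Finset.sum_sub_distrib, ← Finset.mul_sum,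
    ← Nat.cast_sum, sum_twoLetterRow]
  simp

/-- As Schur polynomials are symmetric, variables may be substituted in any order. -/
theorem aeval_comp_equiv_schurPoly {R : Type*} [CommRing R] [Algebra ℤ R] {μ : YoungDiagram}
    {n N : ℕ} (g : Fin N → R) (σ : Fin n ≃ Fin N) :
    MvPolynomial.aeval (g ∘ σ) (schurPoly μ n) = MvPolynomial.aeval g (schurPoly μ N) := by
  obtain rfl : n = N := by simpa using Fintype.card_congr σ
  exact aeval_comp_schurPoly g σ

theorem plethysmSL2_eq_aeval (μ : YoungDiagram) (h : ℕ) :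
    plethysmSL2 μ h = MvPolynomial.aeval (fun a : Fin (h + 1) => (T (2 * (a : ℤ) - h) : ℤ[T;T⁻¹]))
      (schurPoly μ (h + 1)) := by
  let e := Equiv.ofBijective _ (twoLetterRow_bijective h)
  rw [← aeval_comp_equiv_schurPoly _ ((Fintype.equivFin (SSYT (oneRow h) 2)).symm.trans e.symm),
    plethysmSL2, plethysm, MvPolynomial.comp_aeval_apply]
  congr 2
  funext i
  rw [Function.comp_apply, ← aeval_weightMonomial_twoLetterRow]
  congr 2
  exact (e.apply_symm_apply _).symm

theorem plethysmSL2_eq_sum (μ : YoungDiagram) (h : ℕ) :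
    plethysmSL2 μ h =
      ∑ S : SSYT μ (h + 1), ∏ c ∈ μ.cells, (T (2 * (S.1 c.1 c.2 : ℤ) - h) : ℤ[T;T⁻¹]) := by
  rw [plethysmSL2_eq_aeval]
  exact aeval_schurPoly _ (fun m => T (2 * (m : ℤ) - h)) fun _ => rfl

theorem invert_plethysmSL2 (μ : YoungDiagram) (h : ℕ) :
    invert (plethysmSL2 μ h) = plethysmSL2 μ h := by
  have hc : ∀ p : MvPolynomial (Fin (h + 1)) ℤ, ∀ g : Fin (h + 1) → ℤ[T;T⁻¹],
      invert (MvPolynomial.aeval g p) = MvPolynomial.aeval (fun i => invert (g i)) p :=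
    fun p g => MvPolynomial.comp_aeval_apply g (invert (R := ℤ)).toAlgHom p
  rw [plethysmSL2_eq_aeval, hc]
  conv_rhs => rw [← aeval_comp_schurPoly _ Fin.revPerm]
  congr 2
  funext a
  have := a.2
  simp only [invert_T, Function.comp_apply, Fin.revPerm_apply, Fin.val_rev]
  congr 1
  omega

end Plethysm

/-! ### Lattice points of the dilated coarse chambers -/

section LatticePoints

open LaurentPolynomial

variable {μ : YoungDiagram}

theorem quantumEhrhartPoly_dilatedCoarseChamber (Q : StandardYoungTableau μ) (h : ℕ)
    [DecidablePred fun v : Fin μ.card → Fin (h + 1) => recordingTableau v = Q.entry] :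
    quantumEhrhartPoly (dilatedCoarseChamber Q h) h =
      ∑ v : Fin μ.card → Fin (h + 1) with recordingTableau v = Q.entry,
        ∏ i, (T (2 * (v i : ℤ) - h) : ℤ[T;T⁻¹]) := by
  let φ : (Fin μ.card → Fin (h + 1)) → Fin μ.card → ℝ := fun v i => ((v i : ℕ) : ℝ) - (h : ℝ) / 2
  have hφ : Function.Injective φ := fun v v' e => by
    funext i
    have := congrFun e i
    simp only [φ, sub_left_inj, Nat.cast_inj] at this
    exact Fin.ext this
  have hmono : StrictMono fun x : Fin (h + 1) => ((x : ℕ) : ℝ) :=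
    Nat.strictMono_cast.comp Fin.val_strictMono
  have hset : ((fun x : Fin μ.card → ℝ => fun i => x i - (h : ℝ) / 2) '' dilatedCoarseChamber Q h) ∩
      shiftedLattice μ.card h = φ '' (Finset.univ.filter fun v : Fin μ.card → Fin (h + 1) =>
        recordingTableau v = Q.entry : Finset _) := by
    ext y
    simp only [Set.mem_inter_iff, Set.mem_image, Finset.coe_filter, Finset.mem_univ, true_and,
      Set.mem_ofPred_eq]
    constructor
    · rintro ⟨⟨x, ⟨hx, hxQ⟩, rfl⟩, hy⟩
      -- The points of the shifted lattice come from points with integral coordinates.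
      have hn : ∀ i, ∃ n : Fin (h + 1), x i = ((n : ℕ) : ℝ) := fun i => by
        obtain ⟨n, hn⟩ := hy i
        have e : x i = ((h + n : ℤ) : ℝ) := by
          push_cast
          linarith
        have h0 : (0 : ℤ) ≤ h + n := by
          have := (hx i).1
          rw [e] at this
          exact_mod_cast this
        have h1 : (h + n : ℤ) ≤ h := by
          have := (hx i).2
          rw [e] at this
          exact_mod_cast this
        refine ⟨⟨(h + n : ℤ).toNat, by omega⟩, ?_⟩
        rw [e]
        have : (((h + n : ℤ).toNat : ℤ) : ℝ) = ((h + n : ℤ) : ℝ) := by rw [Int.toNat_of_nonneg h0]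
        rw [← this, Int.cast_natCast]
      choose v hv using hn
      have hxv : x = fun i => ((v i : ℕ) : ℝ) := funext hv
      subst hxv
      exact ⟨v, by rw [← hxQ]; exact (recordingTableau_comp hmono v).symm, rfl⟩
    · rintro ⟨v, hv, rfl⟩
      refine ⟨⟨fun i => ((v i : ℕ) : ℝ), ⟨fun i => ⟨by positivity, ?_⟩, ?_⟩, rfl⟩, fun i => ?_⟩
      · exact Nat.cast_le.2 (Nat.lt_succ_iff.1 (v i).2)
      · rw [← hv]
        exact recordingTableau_comp hmono v
      · refine ⟨(v i : ℤ) - h, ?_⟩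
        simp only [φ]
        push_cast
        ring
  rw [quantumEhrhartPoly, hset, finsum_mem_image hφ.injOn, finsum_mem_coe_finset]
  refine Finset.sum_congr rfl fun v _ => ?_
  rw [prod_T]
  congr 1
  rw [Int.floor_eq_iff]
  have : 2 * ∑ i, φ v i = ((∑ i, (2 * (v i : ℤ) - h) : ℤ) : ℝ) := by
    rw [Finset.mul_sum]
    push_cast
    refine Finset.sum_congr rfl fun i _ => ?_
    simp only [φ]
    ring
  rw [this]
  exact ⟨le_rfl, by linarith⟩

theorem quantumEhrhartSeries_dilatedCoarseChamber (Q : StandardYoungTableau μ) :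
    quantumEhrhartSeries (dilatedCoarseChamber Q) = PowerSeries.mk fun h => plethysmSL2 μ h := by
  classical
  ext1 h
  rw [quantumEhrhartSeries, PowerSeries.coeff_mk, PowerSeries.coeff_mk,
    quantumEhrhartPoly_dilatedCoarseChamber, plethysmSL2_eq_sum]
  exact sum_words_eq_sum_tableaux Q (h + 1) fun m => T (2 * (m : ℤ) - h)

end LatticePoints

end SL2Plethysm

theorem mainTheorem3 (μ : YoungDiagram) :
    (∀ h : ℕ, ∃! a : ℕ →₀ ℤ, SL2Plethysm.IsQIntExpansion (SL2Plethysm.plethysmSL2 μ h) a) ∧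
    (∀ Q : SL2Plethysm.StandardYoungTableau μ,
      SL2Plethysm.quantumEhrhartSeries (SL2Plethysm.dilatedCoarseChamber Q) =
        SL2Plethysm.QEhr μ) ∧
    SL2Plethysm.QEhr μ = PowerSeries.mk (fun h => SL2Plethysm.plethysmSL2 μ h) ∧
    SL2Plethysm.genFun μ =
      SL2Plethysm.PT
        (PowerSeries.C (LaurentPolynomial.T 1 - LaurentPolynomial.T (-1)) *
          SL2Plethysm.QEhr μ) := by
  have hex : ∀ h, ∃ a, SL2Plethysm.IsQIntExpansion (SL2Plethysm.plethysmSL2 μ h) a := fun h =>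
    SL2Plethysm.exists_isQIntExpansion (SL2Plethysm.invert_plethysmSL2 μ h)
  have hQ : SL2Plethysm.QEhr μ = PowerSeries.mk fun h => SL2Plethysm.plethysmSL2 μ h :=
    SL2Plethysm.quantumEhrhartSeries_dilatedCoarseChamber _
  refine ⟨fun h => ?_, fun Q => ?_, hQ, ?_⟩
  · obtain ⟨a, ha⟩ := hex h
    exact ⟨a, ha, fun b hb => hb.eq ha⟩
  · rw [hQ, SL2Plethysm.quantumEhrhartSeries_dilatedCoarseChamber]
  · ext1 h
    rw [SL2Plethysm.genFun, SL2Plethysm.PT, PowerSeries.coeff_mk, PowerSeries.coeff_mk,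
      PowerSeries.coeff_C_mul, hQ, PowerSeries.coeff_mk]
    exact (SL2Plethysm.IsQIntExpansion.positivePart_mul (Classical.epsilon_spec (hex h))).symm
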